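/- Let $n\ge 3$, $\mu\in[1/2,1)$, and let $r_1\ge r_2\ge\dots\ge r_n>0$. In the heterogeneous Deffuant–Weisbuch gossip model, $n$ agents hold opinions $x(t)=(x_1(t),\dots,x_n(t))\in\mathbb{R}^n$ at times $t=0,1,2,\dots$. At each time $t$ an unordered pair $\{i_t,j_t\}$ of distinct agents is selected uniformly among the $n(n-1)/2$ such pairs, independently over time and of $x(0)$, and $$x_{i_t}(t+1)=x_{i_t}(t)+\mu\,\mathbf 1_{\{|x_{j_t}(t)-x_{i_t}(t)|\le r_{i_t}\}}\,(x_{j_t}(t)-x_{i_t}(t)),$$ $$x_{j_t}(t+1)=x_{j_t}(t)+\mu\,\mathbf 1_{\{|x_{j_t}(t)-x_{i_t}(t)|\le r_{j_t}\}}\,(x_{i_t}(t)-x_{j_t}(t)),$$ while $x_k(t+1)=x_k(t)$ for $k\notin\{i_t,j_t\}$. Then for any (deterministic or random) initial state $x(0)\in[0,1]^n$ there is a random vector $x^*\in[0,1]^n$ such that: (i) for all $i\ne j$, either $x_i^*=x_j^*$ or $|x_i^*-x_j^*|>\max\{r_i,r_j\}$, and $x(t)\to x^*$ almost surely as $t\to\infty$;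 (ii) for every integer $t\ge 0$, with $\|\cdot\|$ the Euclidean norm, $$\mathbb{E}\|x(t)-x^*\|^2\le n\,c^{\lfloor t/(2(T+1))\rfloor}+\frac n4\Bigl(1-\frac{8\mu(1-\mu)}{n(n-1)}\Bigr)^{\lfloor t/2\rfloor},$$ where $$T=(n-1)^2\Bigl(1+\Bigl\lceil\log_{1-\mu}\frac{r_n}{r_1}\Bigr\rceil\Bigr)\max\Bigl\{0,\Bigl\lceil\frac{1-r_n}{(1-\mu)^2r_n}\Bigr\rceil\Bigr\},\qquad c=1-\frac{2^T}{n^T(n-1)^T},$$ and $0^0=1$. -/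

import Mathlib

open MeasureTheory ProbabilityTheory Filter Topology

noncomputable section

/-- The set of unordered pairs of distinct agents, each represented as `(i, j)` with `i < j`. -/
abbrev AgentPair (n : ℕ) : Type := {p : Fin n × Fin n // p.1 < p.2}

/-- One update of the Deffuant-Weisbuch model with weighting factor `μ` and confidence bounds `r`
when the pair `p = {i, j}` is selected: `i` moves towards `j` iff `|x j - x i| ≤ r i`, `j` moves
towards `i` iff `|x j - x i| ≤ r j`, and all other opinions are unchanged. -/
def dwStep {n : ℕ} (μ : ℝ) (r : Fin n → ℝ) (x : EuclideanSpace ℝ (Fin n)) (p : AgentPair n) :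
    EuclideanSpace ℝ (Fin n) :=
  WithLp.toLp 2 fun k =>
    let i := p.1.1
    let j := p.1.2
    if k = i then x i + μ * (if |x j - x i| ≤ r i then 1 else 0) * (x j - x i)
    else if k = j then x j + μ * (if |x j - x i| ≤ r j then 1 else 0) * (x i - x j)
    else x k

/-- The opinion vector `x(t)` of the model started at `x₀` when the pair `e t` is selected at each
time `t`. -/
def dwState {n : ℕ} (μ : ℝ) (r : Fin n → ℝ) (x₀ : EuclideanSpace ℝ (Fin n))
    (e : ℕ → AgentPair n) : ℕ → EuclideanSpace ℝ (Fin n)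
  | 0 => x₀
  | t + 1 => dwStep μ r (dwState μ r x₀ e t) (e t)

/-- `T = (n-1)² (1 + ⌈log_{1-μ} (rmin / rmax)⌉) ⌈(1 - rmin) / ((1-μ)² rmin)⌉`; the ceilings are
natural numbers, so the last factor is `0` when `rmin ≥ 1`. -/
def dwT (n : ℕ) (μ rmax rmin : ℝ) : ℕ :=
  (n - 1) ^ 2 * (1 + ⌈Real.logb (1 - μ) (rmin / rmax)⌉₊) *
    ⌈(1 - rmin) / ((1 - μ) ^ 2 * rmin)⌉₊

/-- `c = 1 - 2^T / (n^T (n-1)^T)`. -/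
def dwC (n T : ℕ) : ℝ := 1 - (2 : ℝ) ^ T / ((n : ℝ) ^ T * ((n : ℝ) - 1) ^ T)

end

/-! Call a state clustered if the agents carry labels such that equally labelled agents are within
every radius of their class, while agents with different labels are farther apart than every radius
of either class. Two facts carry the proof.

Controllability (`reachIn_clustered`): from every state of the unit cube some list of at most `T`
pairs leads to a clustered state. The agent `M` of largest radius in a group does the work. When `M`
hears `k`, repeated selection of the pair shrinks the gap by `1 - μ` until `k` hears `M` too, after
at most `L` such moves; when both move, `μ ≥ 1/2` makes them meet or cross. So `M` can pass agents
one by one, and can pull agents away from an end of the group's range. Either `M` gets stuck in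
front of a gap longer than its radius, which splits the group into two that can be steered
separately, or an end of the range recedes by `(1 - μ)² ρ`, where `ρ` is the smallest radius. Once
the range is at most `ρ`, the group is one cluster.

Contraction (`Clustered.sum_dispersion_dwStep_le`): in a clustered state hearing is symmetric, so
labels persist, class means are conserved, and the squared distance to the vector of class means
shrinks in expectation by the factor `1 - 4μ(1 - μ)/N`, with `N = n(n - 1)/2` pairs.

Clustered states are absorbing and each pair has probability `1/N`, so a block of `T` steps fails to
settle with probability at most `c = 1 - N⁻ᵀ`. The first half of the time is used to settle, the
second half to contract. The squared error is dominated pathwise by the excess, `n` times the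
unsettled indicator plus the dispersion once settled. The excess never increases and its mean tends
to `0`, which gives both the bound (`integral_excess_le`) and almost sure convergence
(`ae_tendsto_excess`). -/

section Dynamics

/-! ### Single updates and elementary manoeuvres of one agent -/

variable {n : ℕ} {μ : ℝ} {r : Fin n → ℝ}

theorem dwStep_apply_fst (μ : ℝ) (r : Fin n → ℝ) (x : EuclideanSpace ℝ (Fin n)) (p : AgentPair n) :
    dwStep μ r x p p.1.1 = x p.1.1 +
      (if |x p.1.2 - x p.1.1| ≤ r p.1.1 then μ * (x p.1.2 - x p.1.1) else 0) := by
  simp only [dwStep, if_true]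
  split_ifs <;> ring

theorem dwStep_apply_snd (μ : ℝ) (r : Fin n → ℝ) (x : EuclideanSpace ℝ (Fin n)) (p : AgentPair n) :
    dwStep μ r x p p.1.2 = x p.1.2 +
      (if |x p.1.1 - x p.1.2| ≤ r p.1.2 then μ * (x p.1.1 - x p.1.2) else 0) := by
  have h : p.1.2 ≠ p.1.1 := p.2.ne'
  simp only [dwStep, if_neg h, if_true, abs_sub_comm (x p.1.2)]
  split_ifs <;> ring

theorem dwStep_apply_of_ne (μ : ℝ) (r : Fin n → ℝ) (x : EuclideanSpace ℝ (Fin n))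
    (p : AgentPair n) {k : Fin n} (h₁ : k ≠ p.1.1) (h₂ : k ≠ p.1.2) :
    dwStep μ r x p k = x k := by
  simp [dwStep, h₁, h₂]

/-- Hides the convention `i < j` in `AgentPair`, so that later arguments may name the two agents in
either order. -/
theorem exists_pair (μ : ℝ) (r : Fin n → ℝ) {i j : Fin n} (h : i ≠ j) :
    ∃ p : AgentPair n, (p.1.1 = i ∧ p.1.2 = j ∨ p.1.1 = j ∧ p.1.2 = i) ∧
      ∀ x, dwStep μ r x p i = x i + (if |x j - x i| ≤ r i then μ * (x j - x i) else 0) ∧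
        dwStep μ r x p j = x j + (if |x i - x j| ≤ r j then μ * (x i - x j) else 0) ∧
        ∀ k, k ≠ i → k ≠ j → dwStep μ r x p k = x k := by
  rcases lt_or_gt_of_ne h with h | h
  · exact ⟨⟨(i, j), h⟩, Or.inl ⟨rfl, rfl⟩, fun x => ⟨dwStep_apply_fst μ r x ⟨(i, j), h⟩,
      dwStep_apply_snd μ r x ⟨(i, j), h⟩, fun k => dwStep_apply_of_ne μ r x ⟨(i, j), h⟩⟩⟩
  · exact ⟨⟨(j, i), h⟩, Or.inr ⟨rfl, rfl⟩, fun x => ⟨dwStep_apply_snd μ r x ⟨(j, i), h⟩,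
      dwStep_apply_fst μ r x ⟨(j, i), h⟩,
      fun k h₁ h₂ => dwStep_apply_of_ne μ r x ⟨(j, i), h⟩ h₂ h₁⟩⟩

/-- Only differences of opinions matter, so the model commutes with reflection. This halves the
control argument: left and right are interchangeable. -/
theorem dwStep_neg (μ : ℝ) (r : Fin n → ℝ) (x : EuclideanSpace ℝ (Fin n)) (p : AgentPair n) :
    dwStep μ r (-x) p = -dwStep μ r x p := by
  ext k
  have e : ∀ i j, |-x i - -x j| = |x i - x j| := fun i j => by
    rw [← abs_neg]; congr 1; ring
  by_cases h₁ : k = p.1.1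
  · subst h₁
    rw [PiLp.neg_apply, dwStep_apply_fst, dwStep_apply_fst]
    simp only [PiLp.neg_apply, e]
    split_ifs <;> ring
  by_cases h₂ : k = p.1.2
  · subst h₂
    rw [PiLp.neg_apply, dwStep_apply_snd, dwStep_apply_snd]
    simp only [PiLp.neg_apply, e]
    split_ifs <;> ring
  · rw [PiLp.neg_apply, dwStep_apply_of_ne _ _ _ _ h₁ h₂, dwStep_apply_of_ne _ _ _ _ h₁ h₂]
    simp

theorem foldl_dwStep_neg (μ : ℝ) (r : Fin n → ℝ) (l : List (AgentPair n)) :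
    ∀ x, l.foldl (dwStep μ r) (-x) = -l.foldl (dwStep μ r) x := by
  induction l with
  | nil => intro x; rfl
  | cons p l ih => intro x; simp only [List.foldl_cons, dwStep_neg, ih]

theorem dwStep_mem_Icc (hμ0 : 0 ≤ μ) (hμ1 : μ ≤ 1) {S : Finset (Fin n)}
    {x : EuclideanSpace ℝ (Fin n)} {a b : ℝ} (hx : ∀ i ∈ S, x i ∈ Set.Icc a b) {p : AgentPair n}
    (h₁ : p.1.1 ∈ S) (h₂ : p.1.2 ∈ S) : ∀ i ∈ S, dwStep μ r x p i ∈ Set.Icc a b := by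
  intro k hk
  obtain ⟨a₁, b₁⟩ := hx _ h₁
  obtain ⟨a₂, b₂⟩ := hx _ h₂
  by_cases e₁ : k = p.1.1
  · subst e₁
    rw [dwStep_apply_fst]
    split_ifs
    · constructor <;> nlinarith
    · simp [a₁, b₁]
  by_cases e₂ : k = p.1.2
  · subst e₂
    rw [dwStep_apply_snd]
    split_ifs
    · constructor <;> nlinarith
    · simp [a₂, b₂]
  · rw [dwStep_apply_of_ne _ _ _ _ e₁ e₂]
    exact hx k hk

theorem foldl_dwStep_mem_Icc (hμ0 : 0 ≤ μ) (hμ1 : μ ≤ 1) {S : Finset (Fin n)} {a b : ℝ}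
    (l : List (AgentPair n)) : ∀ {x : EuclideanSpace ℝ (Fin n)}, (∀ i ∈ S, x i ∈ Set.Icc a b) →
    (∀ p ∈ l, p.1.1 ∈ S ∧ p.1.2 ∈ S) → ∀ i ∈ S, l.foldl (dwStep μ r) x i ∈ Set.Icc a b := by
  induction l with
  | nil => intro x hx _; exact hx
  | cons p l ih =>
    intro x hx hl
    exact ih (dwStep_mem_Icc hμ0 hμ1 hx (hl p (by simp)).1 (hl p (by simp)).2)
      fun q hq => hl q (by simp [hq])

theorem foldl_dwStep_apply_of_notMem {S : Finset (Fin n)} (l : List (AgentPair n)) :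
    ∀ {x : EuclideanSpace ℝ (Fin n)}, (∀ p ∈ l, p.1.1 ∈ S ∧ p.1.2 ∈ S) →
    ∀ i ∉ S, l.foldl (dwStep μ r) x i = x i := by
  induction l with
  | nil => intro x _ i _; rfl
  | cons p l ih =>
    intro x hl i hi
    have hp := hl p (by simp)
    rw [List.foldl_cons, ih (fun q hq => hl q (by simp [hq])) i hi]
    exact dwStep_apply_of_ne _ _ _ _ (fun h => hi (h ▸ hp.1)) fun h => hi (h ▸ hp.2)

/-- From `x`, some sequence of at most `m` pairs of agents of `S` leads to a state satisfying `Q`. -/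
def ReachIn (μ : ℝ) (r : Fin n → ℝ) (S : Finset (Fin n)) (m : ℕ) (x : EuclideanSpace ℝ (Fin n))
    (Q : EuclideanSpace ℝ (Fin n) → Prop) : Prop :=
  ∃ l : List (AgentPair n), l.length ≤ m ∧ (∀ p ∈ l, p.1.1 ∈ S ∧ p.1.2 ∈ S) ∧
    Q (l.foldl (dwStep μ r) x)

namespace ReachIn

variable {S S' : Finset (Fin n)} {m m' : ℕ} {x : EuclideanSpace ℝ (Fin n)}
  {Q Q' : EuclideanSpace ℝ (Fin n) → Prop}

theorem refl (h : Q x) : ReachIn μ r S m x Q := ⟨[], by simp, by simp, h⟩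

theorem mono (h : ReachIn μ r S m x Q) (hS : S ⊆ S') (hm : m ≤ m') (hQ : ∀ y, Q y → Q' y) :
    ReachIn μ r S' m' x Q' := by
  obtain ⟨l, h₁, h₂, h₃⟩ := h
  exact ⟨l, h₁.trans hm, fun p hp => ⟨hS (h₂ p hp).1, hS (h₂ p hp).2⟩, hQ _ h₃⟩

theorem trans (h : ReachIn μ r S m x Q) (h' : ∀ y, Q y → ReachIn μ r S m' y Q') :
    ReachIn μ r S (m + m') x Q' := by
  obtain ⟨l, h₁, h₂, h₃⟩ := h
  obtain ⟨l', h₁', h₂', h₃'⟩ := h' _ h₃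
  refine ⟨l ++ l', by simp; omega, fun p hp => ?_, by rwa [List.foldl_append]⟩
  rcases List.mem_append.1 hp with hp | hp
  exacts [h₂ p hp, h₂' p hp]

theorem of_neg (h : ReachIn μ r S m (-x) Q) : ReachIn μ r S m x (fun y => Q (-y)) := by
  obtain ⟨l, h₁, h₂, h₃⟩ := h
  exact ⟨l, h₁, h₂, by rwa [foldl_dwStep_neg] at h₃⟩

theorem of_step {p : AgentPair n} (h₁ : p.1.1 ∈ S) (h₂ : p.1.2 ∈ S)
    (h : ReachIn μ r S m (dwStep μ r x p) Q) : ReachIn μ r S (m + 1) x Q := by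
  obtain ⟨l, k₁, k₂, k₃⟩ := h
  refine ⟨p :: l, by simpa using k₁, fun q hq => ?_, k₃⟩
  rcases List.mem_cons.1 hq with rfl | hq
  exacts [⟨h₁, h₂⟩, k₂ q hq]

theorem and_mem_Icc (hμ0 : 0 ≤ μ) (hμ1 : μ ≤ 1) (h : ReachIn μ r S m x Q) {a b : ℝ}
    (hx : ∀ i ∈ S, x i ∈ Set.Icc a b) :
    ReachIn μ r S m x (fun y => Q y ∧ ∀ i ∈ S, y i ∈ Set.Icc a b) := by
  obtain ⟨l, h₁, h₂, h₃⟩ := h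
  exact ⟨l, h₁, h₂, h₃, foldl_dwStep_mem_Icc hμ0 hμ1 l hx h₂⟩

/-- Together with `and_mem_Icc`, this lets two groups be steered one after the other without
disturbing each other. -/
theorem and_eq_of_notMem (h : ReachIn μ r S m x Q) :
    ReachIn μ r S m x (fun y => Q y ∧ ∀ i ∉ S, y i = x i) := by
  obtain ⟨l, h₁, h₂, h₃⟩ := h
  exact ⟨l, h₁, h₂, h₃, foldl_dwStep_apply_of_notMem l h₂⟩

end ReachIn

/-- An agent `M` moves right towards `k` until it passes `k` or the threshold `θ`. -/
theorem reachIn_pass (hμ : 1 / 2 ≤ μ) (hμ1 : μ < 1) {S : Finset (Fin n)} {M k : Fin n}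
    (hM : M ∈ S) (hk : k ∈ S) {θ ρ : ℝ} (hρ : ρ ≤ r k) (l : ℕ) :
    ∀ x : EuclideanSpace ℝ (Fin n), x M < x k → x k ≤ x M + r M → x M < θ →
      (x k - x M) * (1 - μ) ^ l ≤ ρ →
      ReachIn μ r S (l + 1) x (fun y => (∀ i, i ≠ M → i ≠ k → y i = x i) ∧ x M ≤ y M ∧ x M ≤ y k ∧
        ((θ ≤ y M ∧ y M < θ + μ * r M) ∨ (y M < θ ∧ y k ≤ y M))) := by
  induction l with
  | zero =>
    intro x h₁ h₂ h₃ h₄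
    have hne : M ≠ k := by rintro rfl; exact lt_irrefl _ h₁
    obtain ⟨p, hp, hstep⟩ := exists_pair μ r hne
    obtain ⟨eM, ek, eo⟩ := hstep x
    have hpS : p.1.1 ∈ S ∧ p.1.2 ∈ S := by
      rcases hp with ⟨a, b⟩ | ⟨a, b⟩ <;> rw [a, b] <;> exact ⟨by assumption, by assumption⟩
    refine ReachIn.of_step hpS.1 hpS.2 (ReachIn.refl ?_)
    have hd : |x k - x M| ≤ r M := by rw [abs_of_pos (by linarith)]; linarith
    have hd' : |x M - x k| ≤ r k := by
      rw [abs_sub_comm, abs_of_pos (by linarith)]; linarith [h₄, pow_zero (1 - μ)]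
    rw [if_pos hd] at eM
    rw [if_pos hd'] at ek
    refine ⟨eo, by nlinarith, by nlinarith, ?_⟩
    rw [eM, ek]
    -- Both agents move here; since `μ ≥ 1/2` they meet or cross. One jump is at most `μ * r M`,
    -- which bounds the overshoot of `θ`.
    rcases le_or_gt θ (x M + μ * (x k - x M)) with h | h
    · left; refine ⟨h, by nlinarith⟩
    · right; refine ⟨h, by nlinarith⟩
  | succ l ih =>
    intro x h₁ h₂ h₃ h₄
    have hne : M ≠ k := by rintro rfl; exact lt_irrefl _ h₁
    obtain ⟨p, hp, hstep⟩ := exists_pair μ r hne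
    obtain ⟨eM, ek, eo⟩ := hstep x
    have hpS : p.1.1 ∈ S ∧ p.1.2 ∈ S := by
      rcases hp with ⟨a, b⟩ | ⟨a, b⟩ <;> rw [a, b] <;> exact ⟨by assumption, by assumption⟩
    refine ReachIn.of_step hpS.1 hpS.2 ?_
    have hd : |x k - x M| ≤ r M := by rw [abs_of_pos (by linarith)]; linarith
    rw [if_pos hd] at eM
    by_cases hd' : |x M - x k| ≤ r k
    · rw [if_pos hd'] at ek
      refine ReachIn.refl ⟨eo, by nlinarith, by nlinarith, ?_⟩
      rw [eM, ek]
      rcases le_or_gt θ (x M + μ * (x k - x M)) with h | h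
      · left; refine ⟨h, by nlinarith⟩
      · right; refine ⟨h, by nlinarith⟩
    -- Only `M` moves: the gap is multiplied by `1 - μ`, which uses up one power in the gap
    -- hypothesis.
    · rw [if_neg hd', add_zero] at ek
      rcases le_or_gt θ (x M + μ * (x k - x M)) with h | h
      · refine ReachIn.refl ⟨eo, by nlinarith, by linarith, Or.inl ⟨?_, ?_⟩⟩ <;> rw [eM]
        · exact h
        · nlinarith
      · refine (ih (dwStep μ r x p) (by rw [eM, ek]; nlinarith) (by rw [eM, ek]; nlinarith)
          (by rw [eM]; exact h) ?_).mono subset_rfl le_rfl ?_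
        · rw [eM, ek]
          calc _ = (x k - x M) * (1 - μ) ^ (l + 1) := by ring
            _ ≤ ρ := h₄
        · rintro y ⟨y₁, y₂, y₃, y₄⟩
          rw [eM] at y₂ y₃
          exact ⟨fun i hi hi' => (y₁ i hi hi').trans (eo i hi hi'), by nlinarith, by nlinarith, y₄⟩

/-- An agent `M` to the right of `j` moves towards `j`, and finally both move. -/
theorem reachIn_pull (hμ : 1 / 2 ≤ μ) (hμ1 : μ < 1) {S : Finset (Fin n)} {M j : Fin n}
    (hM : M ∈ S) (hj : j ∈ S) {a ρ : ℝ} (hρ : ρ ≤ r j) (l : ℕ) :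
    ∀ x : EuclideanSpace ℝ (Fin n), a ≤ x j → x j < x M → x M ≤ x j + r M →
      a + (1 - μ) * ρ ≤ x M → (x M - x j) * (1 - μ) ^ l ≤ ρ →
      ReachIn μ r S (l + 1) x (fun y => (∀ i, i ≠ M → i ≠ j → y i = x i) ∧ y M ≤ x M ∧
        a + (1 - μ) ^ 2 * ρ ≤ y M ∧ a + (1 - μ) ^ 2 * ρ ≤ y j) := by
  have key : ∀ x : EuclideanSpace ℝ (Fin n), a ≤ x j → x j < x M → x M ≤ x j + r M →
      a + (1 - μ) * ρ ≤ x M → x M - x j ≤ r j → ∀ l,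
      ReachIn μ r S (l + 1) x (fun y => (∀ i, i ≠ M → i ≠ j → y i = x i) ∧ y M ≤ x M ∧
        a + (1 - μ) ^ 2 * ρ ≤ y M ∧ a + (1 - μ) ^ 2 * ρ ≤ y j) := by
    intro x h₀ h₁ h₂ h₃ h₄ l
    have hne : M ≠ j := by rintro rfl; exact lt_irrefl _ h₁
    obtain ⟨p, hp, hstep⟩ := exists_pair μ r hne
    obtain ⟨eM, ej, eo⟩ := hstep x
    have hpS : p.1.1 ∈ S ∧ p.1.2 ∈ S := by
      rcases hp with ⟨a, b⟩ | ⟨a, b⟩ <;> rw [a, b] <;> exact ⟨by assumption, by assumption⟩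
    refine ReachIn.of_step hpS.1 hpS.2 (ReachIn.refl ?_)
    have hd : |x j - x M| ≤ r M := by rw [abs_sub_comm, abs_of_pos (by linarith)]; linarith
    have hd' : |x M - x j| ≤ r j := by rw [abs_of_pos (by linarith)]; linarith
    rw [if_pos hd] at eM
    rw [if_pos hd'] at ej
    -- `M` keeps the share `1 - μ` of its margin `(1 - μ) ρ` over `a`; `j` gains at least the share
    -- `μ ≥ 1 - μ` of it.
    have h : a + (1 - μ) ^ 2 * ρ ≤ x M + μ * (x j - x M) := by nlinarith
    exact ⟨eo, by rw [eM]; nlinarith, by rw [eM]; exact h, by rw [ej]; nlinarith⟩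
  induction l with
  | zero =>
    intro x h₀ h₁ h₂ h₃ h₄
    exact key x h₀ h₁ h₂ h₃ (by linarith [h₄, pow_zero (1 - μ)]) 0
  | succ l ih =>
    intro x h₀ h₁ h₂ h₃ h₄
    by_cases hd' : x M - x j ≤ r j
    · exact key x h₀ h₁ h₂ h₃ hd' _
    have hne : M ≠ j := by rintro rfl; exact lt_irrefl _ h₁
    obtain ⟨p, hp, hstep⟩ := exists_pair μ r hne
    obtain ⟨eM, ej, eo⟩ := hstep x
    have hpS : p.1.1 ∈ S ∧ p.1.2 ∈ S := by
      rcases hp with ⟨a, b⟩ | ⟨a, b⟩ <;> rw [a, b] <;> exact ⟨by assumption, by assumption⟩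
    refine ReachIn.of_step hpS.1 hpS.2 ?_
    have hd : |x j - x M| ≤ r M := by rw [abs_sub_comm, abs_of_pos (by linarith)]; linarith
    rw [if_pos hd] at eM
    rw [if_neg (by rwa [abs_of_pos (by linarith)]), add_zero] at ej
    -- The margin survives a one-sided move: `j` did not hear `M`, so the old gap exceeded `ρ` and
    -- the new one exceeds `(1 - μ) ρ`.
    refine (ih (dwStep μ r x p) (by rw [ej]; exact h₀) (by rw [eM, ej]; nlinarith)
      (by rw [eM, ej]; nlinarith) (by rw [eM]; nlinarith) ?_).mono subset_rfl le_rfl ?_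
    · rw [eM, ej]
      calc _ = (x M - x j) * (1 - μ) ^ (l + 1) := by ring
        _ ≤ ρ := h₄
    · rintro y ⟨y₁, y₂, y₃, y₄⟩
      rw [eM] at y₂
      exact ⟨fun i hi hi' => (y₁ i hi hi').trans (eo i hi hi'), by nlinarith, y₃, y₄⟩

/-- Each pass removes one agent from those ahead of `M` and below `B`, so at most `c` passes occur.
While `M` is below `θ`, every agent ahead within its reach is below `B`; hence if nobody is left to
pass, `M` faces a gap longer than `r M`. The lower bound on each `y i` ensures that no agent is
dragged back behind both its own start and that of `M`. -/
theorem reachIn_travel (hμ : 1 / 2 ≤ μ) (hμ1 : μ < 1) {S : Finset (Fin n)} {M : Fin n}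
    (hM : M ∈ S) {θ ρ B : ℝ} {L : ℕ} (hρ : ∀ i ∈ S, ρ ≤ r i) (hL : r M * (1 - μ) ^ L ≤ ρ)
    (hB : θ + r M ≤ B) (c : ℕ) :
    ∀ x : EuclideanSpace ℝ (Fin n), x M < θ → (S.filter fun i => x M < x i ∧ x i < B).card ≤ c →
      ReachIn μ r S (c * (L + 1)) x (fun y => (∀ i, min (x i) (x M) ≤ y i) ∧
        ((θ ≤ y M ∧ y M < θ + μ * r M) ∨
          (y M < θ ∧ ∀ i ∈ S, y i ≤ y M ∨ y M + r M < y i))) := by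
  induction c with
  | zero =>
    intro x h₁ h₂
    refine ReachIn.refl ⟨fun i => min_le_left _ _, Or.inr ⟨h₁, fun i hi => ?_⟩⟩
    by_contra! h
    have : i ∈ S.filter fun i => x M < x i ∧ x i < B :=
      Finset.mem_filter.2 ⟨hi, h.1, by linarith⟩
    rw [Finset.card_eq_zero.1 (Nat.le_zero.1 h₂)] at this
    simp at this
  | succ c ih =>
    intro x h₁ h₂
    by_cases hk : ∃ k ∈ S, x M < x k ∧ x k ≤ x M + r M
    swap
    · push Not at hk
      refine ReachIn.refl ⟨fun i => min_le_left _ _, Or.inr ⟨h₁, fun i hi => ?_⟩⟩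
      exact (le_or_gt (x i) (x M)).imp_right (hk i hi)
    obtain ⟨k, hkS, hk₁, hk₂⟩ := hk
    have hpow : 0 ≤ (1 - μ) ^ L := pow_nonneg (by linarith) _
    have := reachIn_pass hμ hμ1 hM hkS (hρ k hkS) L x hk₁ hk₂ h₁
      ((mul_le_mul_of_nonneg_right (by linarith) hpow).trans hL)
    rw [show (c + 1) * (L + 1) = L + 1 + c * (L + 1) by ring]
    refine this.trans ?_
    rintro y ⟨y₁, y₂, y₃, y₄⟩
    have hmin : ∀ i, min (x i) (x M) ≤ y i := by
      intro i
      by_cases e₁ : i = M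
      · subst e₁; simpa using y₂
      by_cases e₂ : i = k
      · subst e₂; exact (min_le_right _ _).trans y₃
      · rw [y₁ i e₁ e₂]; exact min_le_left _ _
    rcases y₄ with y₄ | ⟨y₄, y₅⟩
    · exact ReachIn.refl ⟨hmin, Or.inl y₄⟩
    · refine (ih y y₄ ?_).mono subset_rfl le_rfl ?_
      · have hkm : k ∈ S.filter fun i => x M < x i ∧ x i < B :=
          Finset.mem_filter.2 ⟨hkS, hk₁, by linarith⟩
        have : (S.filter fun i => y M < y i ∧ y i < B) ⊆
            (S.filter fun i => x M < x i ∧ x i < B).erase k := by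
          intro i hi
          obtain ⟨hiS, hi₁, hi₂⟩ := Finset.mem_filter.1 hi
          have e₁ : i ≠ M := by rintro rfl; exact lt_irrefl _ hi₁
          have e₂ : i ≠ k := by rintro rfl; exact absurd hi₁ (not_lt.2 y₅)
          rw [y₁ i e₁ e₂] at hi₁ hi₂
          exact Finset.mem_erase.2 ⟨e₂, Finset.mem_filter.2 ⟨hiS, by linarith, hi₂⟩⟩
        have h := Finset.card_le_card this
        rw [Finset.card_erase_of_mem hkm] at h
        omega
      · rintro z ⟨z₁, z₂⟩
        refine ⟨fun i => le_trans ?_ (z₁ i), z₂⟩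
        exact le_min (hmin i) ((min_le_right _ _).trans y₂)

end Dynamics

/-! ### Steering every state to a clustered one -/

section Control

variable {n : ℕ} {μ : ℝ} {r : Fin n → ℝ}

/-- Either the opinions of `S` split across a gap longer than `R`, or an end of `[a, b]` has been
cleared on a length `δ`. -/
def Progress (S : Finset (Fin n)) (R a b δ : ℝ) (y : EuclideanSpace ℝ (Fin n)) : Prop :=
  (∃ u v, u + R < v ∧ (∃ i ∈ S, y i ≤ u) ∧ (∃ i ∈ S, v ≤ y i) ∧ ∀ i ∈ S, y i ≤ u ∨ v ≤ y i) ∨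
    (∀ i ∈ S, a + δ ≤ y i) ∨ ∀ i ∈ S, y i ≤ b - δ

theorem Progress.neg {S : Finset (Fin n)} {R a b δ : ℝ} {y : EuclideanSpace ℝ (Fin n)}
    (h : Progress S R (-b) (-a) δ (-y)) : Progress S R a b δ y := by
  rcases h with ⟨u, v, h, ⟨i, hi, hiu⟩, ⟨j, hj, hjv⟩, h'⟩ | h | h
  · simp only [PiLp.neg_apply] at hiu hjv h'
    refine Or.inl ⟨-v, -u, by linarith, ⟨j, hj, by linarith⟩, ⟨i, hi, by linarith⟩, fun k hk => ?_⟩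
    rcases h' k hk with h' | h'
    · right; linarith
    · left; linarith
  · right; right
    intro i hi
    have := h i hi
    simp only [PiLp.neg_apply] at this
    linarith
  · right; left
    intro i hi
    have := h i hi
    simp only [PiLp.neg_apply] at this
    linarith

/-- Agents beyond the gap give a split between `M` and the nearest of them; if there are none, `M`
is rightmost and the right end is clear. -/
theorem progress_of_isolated {S : Finset (Fin n)} {M : Fin n} (hM : M ∈ S) {R a b δ : ℝ}
    {y : EuclideanSpace ℝ (Fin n)} (h : ∀ i ∈ S, y i ≤ y M ∨ y M + R < y i)
    (hb : y M ≤ b - δ) : Progress S R a b δ y := by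
  by_cases hS : (S.filter fun i => y M + R < y i).Nonempty
  · obtain ⟨j, hj, hmin⟩ := Finset.exists_min_image _ (fun i => y i) hS
    obtain ⟨hjS, hj⟩ := Finset.mem_filter.1 hj
    refine Or.inl ⟨y M, y j, hj, ⟨M, hM, le_rfl⟩, ⟨j, hjS, le_rfl⟩, fun i hi => ?_⟩
    exact (h i hi).imp_right fun h => hmin i (Finset.mem_filter.2 ⟨hi, h⟩)
  · refine Or.inr (Or.inr fun i hi => ?_)
    rcases h i hi with h | h
    · linarith
    · exact absurd ⟨i, Finset.mem_filter.2 ⟨hi, h⟩⟩ hS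

theorem card_filter_le_sub_two {S : Finset (Fin n)} {i j : Fin n} (hij : i ≠ j)
    (P : Fin n → Prop) [DecidablePred P] (hi : ¬ P i) (hj : ¬ P j) :
    (S.filter P).card ≤ n - 2 := by
  have : S.filter P ⊆ (Finset.univ.erase i).erase j := by
    intro k hk
    have := (Finset.mem_filter.1 hk).2
    refine Finset.mem_erase.2 ⟨?_, Finset.mem_erase.2 ⟨?_, Finset.mem_univ _⟩⟩ <;> rintro rfl
    exacts [hj this, hi this]
  refine (Finset.card_le_card this).trans ?_
  rw [Finset.card_erase_of_mem (Finset.mem_erase.2 ⟨hij.symm, Finset.mem_univ _⟩),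
    Finset.card_erase_of_mem (Finset.mem_univ _), Finset.card_univ, Fintype.card_fin]
  omega

/-- If `M` is to the right of `a + (1 - μ) ρ` and within reach of `a`, then one more agent can be
moved out of `[a, a + (1 - μ)² ρ)`. -/
theorem reachIn_clear_one (hμ : 1 / 2 ≤ μ) (hμ1 : μ < 1) {S : Finset (Fin n)} {M : Fin n}
    (hM : M ∈ S) {a ρ : ℝ} {L : ℕ} (hρ0 : 0 < ρ) (hρ : ∀ i ∈ S, ρ ≤ r i)
    (hL : r M * (1 - μ) ^ L ≤ ρ) {x : EuclideanSpace ℝ (Fin n)} (hx : ∀ i ∈ S, a ≤ x i)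
    (hM₁ : a + (1 - μ) * ρ ≤ x M) (hM₂ : x M ≤ a + r M) {s : ℕ}
    (hs : (S.filter fun i => x i < a + (1 - μ) ^ 2 * ρ).card ≤ s + 1) :
    ReachIn μ r S (L + 1) x (fun y => a + (1 - μ) ^ 2 * ρ ≤ y M ∧ y M ≤ a + r M ∧
      (S.filter fun i => y i < a + (1 - μ) ^ 2 * ρ).card ≤ s) := by
  have hδ : (1 - μ) ^ 2 * ρ ≤ (1 - μ) * ρ :=
    mul_le_mul_of_nonneg_right (by nlinarith) hρ0.le
  by_cases hA : (S.filter fun i => x i < a + (1 - μ) ^ 2 * ρ).Nonempty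
  swap
  · rw [Finset.not_nonempty_iff_eq_empty] at hA
    exact ReachIn.refl ⟨by linarith, hM₂, by rw [hA]; simp⟩
  obtain ⟨j, hjA⟩ := hA
  obtain ⟨hjS, hj⟩ := Finset.mem_filter.1 hjA
  have hpow : 0 ≤ (1 - μ) ^ L := pow_nonneg (by linarith) _
  have hxj := hx j hjS
  refine (reachIn_pull hμ hμ1 hM hjS (hρ j hjS) L x hxj (by linarith) (by linarith) hM₁
    ((mul_le_mul_of_nonneg_right (by linarith) hpow).trans hL)).mono subset_rfl le_rfl ?_
  rintro y ⟨y₁, y₂, y₃, y₄⟩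
  refine ⟨y₃, y₂.trans hM₂, ?_⟩
  have : (S.filter fun i => y i < a + (1 - μ) ^ 2 * ρ) ⊆
      (S.filter fun i => x i < a + (1 - μ) ^ 2 * ρ).erase j := by
    intro i hi
    obtain ⟨hiS, hi⟩ := Finset.mem_filter.1 hi
    have e₁ : i ≠ M := by rintro rfl; linarith
    have e₂ : i ≠ j := by rintro rfl; linarith
    rw [y₁ i e₁ e₂] at hi
    exact Finset.mem_erase.2 ⟨e₂, Finset.mem_filter.2 ⟨hiS, hi⟩⟩
  have h := Finset.card_le_card this
  rw [Finset.card_erase_of_mem hjA] at h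
  omega

/-- Induction on the number of agents in the left strip. `M` first returns to the window `[a + (1 -
μ) ρ, a + r M]`, passing at most `n - 2` agents, and then pulls one agent out of the strip; `n - 1`
manoeuvres of `L + 1` steps per agent. -/
theorem reachIn_clear (hμ : 1 / 2 ≤ μ) (hμ1 : μ < 1) {S : Finset (Fin n)} {M : Fin n}
    (hM : M ∈ S) {a b ρ : ℝ} {L : ℕ} (hρ0 : 0 < ρ) (hρ : ∀ i ∈ S, ρ ≤ r i)
    (hL : r M * (1 - μ) ^ L ≤ ρ) (hab : ρ < b - a) (s : ℕ) :
    ∀ x : EuclideanSpace ℝ (Fin n), (∀ i ∈ S, x i ∈ Set.Icc a b) →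
      a + (1 - μ) ^ 2 * ρ ≤ x M → x M ≤ a + r M →
      (S.filter fun i => x i < a + (1 - μ) ^ 2 * ρ).card ≤ s →
      ReachIn μ r S (s * (n - 1) * (L + 1)) x (Progress S (r M) a b ((1 - μ) ^ 2 * ρ)) := by
  have hδ : (1 - μ) ^ 2 * ρ ≤ (1 - μ) * ρ :=
    mul_le_mul_of_nonneg_right (by nlinarith) hρ0.le
  have hδ' : (1 - μ) * ρ + (1 - μ) ^ 2 * ρ ≤ ρ := by nlinarith
  induction s with
  | zero =>
    intro x hx h₁ h₂ h₃
    refine ReachIn.refl (Or.inr (Or.inl fun i hi => ?_))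
    by_contra! h
    have : i ∈ S.filter fun i => x i < a + (1 - μ) ^ 2 * ρ := Finset.mem_filter.2 ⟨hi, h⟩
    rw [Finset.card_eq_zero.1 (Nat.le_zero.1 h₃)] at this
    simp at this
  | succ s ih =>
    intro x hx h₁ h₂ h₃
    by_cases hA : (S.filter fun i => x i < a + (1 - μ) ^ 2 * ρ).Nonempty
    swap
    · refine ReachIn.refl (Or.inr (Or.inl fun i hi => ?_))
      by_contra! h
      exact hA ⟨i, Finset.mem_filter.2 ⟨hi, h⟩⟩
    obtain ⟨j, hjA⟩ := hA
    obtain ⟨hjS, hj⟩ := Finset.mem_filter.1 hjA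
    have hne : M ≠ j := by rintro rfl; linarith
    have hn : 2 ≤ n := by
      by_contra hn
      have := M.2; have := j.2
      exact hne (Fin.ext (by omega))
    have travel : ReachIn μ r S ((n - 2) * (L + 1)) x (fun y =>
        Progress S (r M) a b ((1 - μ) ^ 2 * ρ) y ∨
        (a + (1 - μ) * ρ ≤ y M ∧ y M ≤ a + r M ∧
          (S.filter fun i => y i < a + (1 - μ) ^ 2 * ρ).card ≤ s + 1)) := by
      rcases le_or_gt (a + (1 - μ) * ρ) (x M) with h | h
      · exact ReachIn.refl (Or.inr ⟨h, h₂, h₃⟩)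
      refine (reachIn_travel hμ hμ1 hM hρ hL le_rfl (n - 2) x h
        (card_filter_le_sub_two hne _ (by simp)
          fun h => by linarith [h.1])).mono subset_rfl le_rfl ?_
      rintro y ⟨y₁, y₂ | ⟨y₂, y₃⟩⟩
      · right
        -- The overshoot lands inside the window because `(1 - μ) ρ + μ * r M ≤ r M`. No agent has
        -- entered the strip, since `M` started outside it.
        refine ⟨y₂.1, by nlinarith [hρ M hM], (Finset.card_le_card ?_).trans h₃⟩
        intro i hi
        obtain ⟨hiS, hi⟩ := Finset.mem_filter.1 hi
        refine Finset.mem_filter.2 ⟨hiS, ?_⟩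
        by_contra! hxi
        exact absurd hi (not_lt.2 ((le_min hxi h₁).trans (y₁ i)))
      · left
        exact progress_of_isolated hM y₃ (by linarith)
    have hcost : (s + 1) * (n - 1) * (L + 1) =
        (n - 2) * (L + 1) + (L + 1 + s * (n - 1) * (L + 1)) := by
      obtain ⟨k, rfl⟩ := Nat.exists_eq_add_of_le hn
      rw [show 2 + k - 1 = k + 1 by omega, show 2 + k - 2 = k by omega]
      ring
    rw [hcost]
    refine (travel.and_mem_Icc (by linarith) hμ1.le hx).trans ?_
    rintro y ⟨y₁ | ⟨y₁, y₂, y₃⟩, hy⟩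
    · exact ReachIn.refl y₁
    refine ((reachIn_clear_one hμ hμ1 hM hρ0 hρ hL (fun i hi => (hy i hi).1) y₁ y₂
      y₃).and_mem_Icc (by linarith) hμ1.le hy).trans ?_
    rintro z ⟨⟨z₁, z₂, z₃⟩, hz⟩
    exact ih z hz z₁ z₂ z₃

/-- `M` starts in the right half, hence beyond `a + (1 - μ) ρ`. It first travels left to come within
reach of `a`, then clears the left strip. The cost is `(n - 2) + 1 + (n - 2)(n - 1) = (n - 1)²`
manoeuvres. -/
theorem reachIn_progress_of_right (hμ : 1 / 2 ≤ μ) (hμ1 : μ < 1) {S : Finset (Fin n)} {M : Fin n}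
    (hM : M ∈ S) {a b ρ : ℝ} {L : ℕ} (hρ0 : 0 < ρ) (hρ : ∀ i ∈ S, ρ ≤ r i)
    (hL : r M * (1 - μ) ^ L ≤ ρ) (hab : ρ < b - a) {x : EuclideanSpace ℝ (Fin n)}
    (hx : ∀ i ∈ S, x i ∈ Set.Icc a b) (ha : ∃ i ∈ S, x i = a) (hside : a + b ≤ 2 * x M) :
    ReachIn μ r S ((n - 1) ^ 2 * (L + 1)) x (Progress S (r M) a b ((1 - μ) ^ 2 * ρ)) := by
  have hδ : (1 - μ) ^ 2 * ρ ≤ (1 - μ) * ρ :=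
    mul_le_mul_of_nonneg_right (by nlinarith) hρ0.le
  have hρM := hρ M hM
  obtain ⟨j, hjS, hj⟩ := ha
  have hne : M ≠ j := by rintro rfl; linarith
  have hn : 2 ≤ n := by
    by_contra hn
    have := M.2; have := j.2
    exact hne (Fin.ext (by omega))
  have travel : ReachIn μ r S ((n - 2) * (L + 1)) x (fun y =>
      Progress S (r M) a b ((1 - μ) ^ 2 * ρ) y ∨
      (a + (1 - μ) * ρ ≤ y M ∧ y M ≤ a + r M)) := by
    rcases le_or_gt (x M) (a + r M) with h | h
    · exact ReachIn.refl (Or.inr ⟨by nlinarith, h⟩)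
    -- Reflected, the threshold is `a + r M` and the overshoot leaves `M` beyond `a + (1 - μ) * r
    -- M`, so it lands in the window. The agent at `a` lies on the bound `B` and is not counted.
    have := (reachIn_travel (x := -x) (θ := -a - r M) (B := -a) hμ hμ1 hM hρ hL (by linarith)
      (n - 2) (by simp only [PiLp.neg_apply]; linarith)
      (card_filter_le_sub_two hne _ (by simp)
        fun h => by have := h.2; simp only [PiLp.neg_apply] at this; linarith)).of_neg
    refine this.mono subset_rfl le_rfl ?_
    rintro y ⟨-, y₂ | ⟨y₂, y₃⟩⟩ <;> simp only [PiLp.neg_apply] at y₂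
    · exact Or.inr ⟨by nlinarith, by linarith⟩
    · left
      apply Progress.neg
      exact progress_of_isolated hM y₃ (by simp only [PiLp.neg_apply]; nlinarith)
  have hcost : (n - 1) ^ 2 * (L + 1) =
      (n - 2) * (L + 1) + (L + 1 + (n - 2) * (n - 1) * (L + 1)) := by
    obtain ⟨k, rfl⟩ := Nat.exists_eq_add_of_le hn
    rw [show 2 + k - 1 = k + 1 by omega, show 2 + k - 2 = k by omega]
    ring
  rw [hcost]
  refine (travel.and_mem_Icc (by linarith) hμ1.le hx).trans ?_
  rintro y ⟨y₁ | ⟨y₁, y₂⟩, hy⟩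
  · exact ReachIn.refl y₁
  have hcard : (S.filter fun i => y i < a + (1 - μ) ^ 2 * ρ).card ≤ n - 2 + 1 := by
    have : (S.filter fun i => y i < a + (1 - μ) ^ 2 * ρ) ⊆ Finset.univ.erase M := by
      intro i hi
      have := (Finset.mem_filter.1 hi).2
      refine Finset.mem_erase.2 ⟨?_, Finset.mem_univ _⟩
      rintro rfl
      linarith
    refine (Finset.card_le_card this).trans ?_
    rw [Finset.card_erase_of_mem (Finset.mem_univ _), Finset.card_univ, Fintype.card_fin]
    omega
  refine ((reachIn_clear_one hμ hμ1 hM hρ0 hρ hL (fun i hi => (hy i hi).1) y₁ y₂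
    hcard).and_mem_Icc (by linarith) hμ1.le hy).trans ?_
  rintro z ⟨⟨z₁, z₂, z₃⟩, hz⟩
  exact reachIn_clear hμ hμ1 hM hρ0 hρ hL hab (n - 2) z hz z₁ z₂ z₃

theorem reachIn_progress (hμ : 1 / 2 ≤ μ) (hμ1 : μ < 1) {S : Finset (Fin n)} {M : Fin n}
    (hM : M ∈ S) {a b ρ : ℝ} {L : ℕ} (hρ0 : 0 < ρ) (hρ : ∀ i ∈ S, ρ ≤ r i)
    (hL : r M * (1 - μ) ^ L ≤ ρ) (hab : ρ < b - a) {x : EuclideanSpace ℝ (Fin n)}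
    (hx : ∀ i ∈ S, x i ∈ Set.Icc a b) (ha : ∃ i ∈ S, x i = a) (hb : ∃ i ∈ S, x i = b) :
    ReachIn μ r S ((n - 1) ^ 2 * (L + 1)) x (Progress S (r M) a b ((1 - μ) ^ 2 * ρ)) := by
  rcases le_total (a + b) (2 * x M) with h | h
  · exact reachIn_progress_of_right hμ hμ1 hM hρ0 hρ hL hab hx ha h
  · obtain ⟨j, hjS, hj⟩ := hb
    refine (reachIn_progress_of_right (x := -x) (a := -b) (b := -a) hμ hμ1 hM hρ0 hρ hL
      (by linarith) ?_ ⟨j, hjS, by simp [hj]⟩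
      (by simp only [PiLp.neg_apply]; linarith)).of_neg.mono subset_rfl le_rfl
      fun y hy => hy.neg
    intro i hi
    have := hx i hi
    simp only [PiLp.neg_apply]
    exact ⟨by linarith [this.2], by linarith [this.1]⟩

/-- Any two agents of `S` with the same label are within reach of their whole class, and each class
is out of reach of all the other agents of `S`. -/
def Clustered (r : Fin n → ℝ) (S : Finset (Fin n)) (f : Fin n → Fin n)
    (x : EuclideanSpace ℝ (Fin n)) : Prop :=
  ∀ i ∈ S, ∀ j ∈ S, (f i = f j → ∀ k ∈ S, f k = f i → |x i - x j| ≤ r k) ∧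
    (f i ≠ f j → ∀ k ∈ S, f k = f i → r k < |x i - x j|)

theorem Clustered.congr {S : Finset (Fin n)} {f : Fin n → Fin n} {x y : EuclideanSpace ℝ (Fin n)}
    (h : Clustered r S f x) (hxy : ∀ i ∈ S, y i = x i) : Clustered r S f y := by
  intro i hi j hj
  rw [hxy i hi, hxy j hj]
  exact h i hi j hj

/-- Labels are members of their own part, so the two labellings cannot collide, and the gap exceeds
every radius involved. -/
theorem Clustered.union {S₁ S₂ : Finset (Fin n)} {f₁ f₂ : Fin n → Fin n} {R : ℝ}
    {x : EuclideanSpace ℝ (Fin n)} (h₁ : Clustered r S₁ f₁ x) (h₂ : Clustered r S₂ f₂ x)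
    (hf₁ : ∀ i ∈ S₁, f₁ i ∈ S₁) (hf₂ : ∀ i ∈ S₂, f₂ i ∈ S₂) (hd : Disjoint S₁ S₂)
    (hR : ∀ i ∈ S₁ ∪ S₂, r i ≤ R) (hgap : ∀ i ∈ S₁, ∀ j ∈ S₂, x i + R < x j) :
    Clustered r (S₁ ∪ S₂) (fun i => if i ∈ S₁ then f₁ i else f₂ i) x := by
  have hn : ∀ i ∈ S₂, i ∉ S₁ := fun i h₂ h₁ => Finset.disjoint_left.1 hd h₁ h₂
  intro i hi j hj
  have gap' : ∀ i ∈ S₁, ∀ j ∈ S₂, ∀ k ∈ S₁ ∪ S₂, r k < |x i - x j| ∧ r k < |x j - x i| := by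
    intro i hi j hj k hk
    have h := hgap i hi j hj
    have hk := hR k hk
    rw [abs_sub_comm (x i), and_self]
    exact lt_of_lt_of_le (by linarith) (le_abs_self _)
  have lab₁ : ∀ i ∈ S₁, ∀ k ∈ S₁ ∪ S₂, (if k ∈ S₁ then f₁ k else f₂ k) = f₁ i →
      k ∈ S₁ ∧ f₁ k = f₁ i := by
    intro i hi k hk h
    split_ifs at h with hk'
    · exact ⟨hk', h⟩
    · exact absurd (hf₁ i hi) (hn _ (h ▸ hf₂ k ((Finset.mem_union.1 hk).resolve_left hk')))
  have lab₂ : ∀ i ∈ S₂, ∀ k ∈ S₁ ∪ S₂, (if k ∈ S₁ then f₁ k else f₂ k) = f₂ i →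
      k ∈ S₂ ∧ f₂ k = f₂ i := by
    intro i hi k hk h
    split_ifs at h with hk'
    · exact absurd (hf₁ k hk') (hn _ (h ▸ hf₂ i hi))
    · exact ⟨(Finset.mem_union.1 hk).resolve_left hk', h⟩
  rcases Finset.mem_union.1 hi with hi' | hi' <;> rcases Finset.mem_union.1 hj with hj' | hj'
  · simp only [hi', hj', if_true]
    exact ⟨fun he k hk hke => (h₁ i hi' j hj').1 he k (lab₁ i hi' k hk hke).1
      (lab₁ i hi' k hk hke).2, fun he k hk hke => (h₁ i hi' j hj').2 he k
      (lab₁ i hi' k hk hke).1 (lab₁ i hi' k hk hke).2⟩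
  · simp only [hi', hn j hj', if_true, if_false]
    refine ⟨fun h => absurd (hf₁ i hi') (hn _ (h ▸ hf₂ j hj')), fun _ k hk _ => ?_⟩
    exact (gap' i hi' j hj' k hk).1
  · simp only [hj', hn i hi', if_true, if_false]
    refine ⟨fun h => absurd (hf₁ j hj') (hn _ (h ▸ hf₂ i hi')), fun _ k hk _ => ?_⟩
    exact (gap' j hj' i hi' k hk).2
  · simp only [hn j hj', hn i hi', if_false]
    exact ⟨fun he k hk hke => (h₂ i hi' j hj').1 he k (lab₂ i hi' k hk hke).1
      (lab₂ i hi' k hk hke).2, fun he k hk hke => (h₂ i hi' j hj').2 he k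
      (lab₂ i hi' k hk hke).1 (lab₂ i hi' k hk hke).2⟩

theorem clustered_of_abs_le {S : Finset (Fin n)} {x : EuclideanSpace ℝ (Fin n)} {ρ : ℝ}
    (hρ : ∀ i ∈ S, ρ ≤ r i) (h : ∀ i ∈ S, ∀ j ∈ S, x i - x j ≤ ρ) :
    ∃ f : Fin n → Fin n, (∀ i ∈ S, f i ∈ S) ∧ Clustered r S f x := by
  rcases S.eq_empty_or_nonempty with rfl | ⟨i₀, hi₀⟩
  · exact ⟨id, by simp, by intro i hi; simp at hi⟩
  · refine ⟨fun _ => i₀, fun _ _ => hi₀, fun i hi j hj => ⟨fun _ k hk _ => ?_, fun h => absurd rfl h⟩⟩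
    exact abs_le.2 ⟨by linarith [h j hj i hi, hρ k hk], by linarith [h i hi j hj, hρ k hk]⟩

/-- Rounding up costs less than `2` in total, which the slack absorbs. A nonpositive argument has
natural ceiling `0`, so that case rests on the separate bounds. -/
theorem ceil_add_ceil_le {p q : ℝ} {K : ℕ} (hp : p ≤ K) (hq : q ≤ K) (hpq : p + q ≤ K - 2) :
    ⌈p⌉₊ + ⌈q⌉₊ ≤ K := by
  rcases le_or_gt p 0 with h | h
  · rw [Nat.ceil_eq_zero.2 h, zero_add]
    exact Nat.ceil_le.2 hq
  rcases le_or_gt q 0 with h' | h'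
  · rw [Nat.ceil_eq_zero.2 h', add_zero]
    exact Nat.ceil_le.2 hp
  have h₁ := Nat.ceil_lt_add_one h.le
  have h₂ := Nat.ceil_lt_add_one h'.le
  have : ((⌈p⌉₊ + ⌈q⌉₊ : ℕ) : ℝ) ≤ K := by push_cast; linarith
  exact_mod_cast this

/-- Controllability: a group of agents of diameter at most `ρ + K (1 - μ)² ρ` can be brought to a
clustered state within `K (n - 1)² (L + 1)` steps. -/
theorem reachIn_clustered (hμ : 1 / 2 ≤ μ) (hμ1 : μ < 1) {ρ : ℝ} {L : ℕ} (hρ0 : 0 < ρ)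
    (hρ : ∀ i, ρ ≤ r i) (hL : ∀ i, r i * (1 - μ) ^ L ≤ ρ) (K : ℕ) :
    ∀ (S : Finset (Fin n)) (x : EuclideanSpace ℝ (Fin n)),
      (∀ i ∈ S, ∀ j ∈ S, x i - x j ≤ ρ + K * ((1 - μ) ^ 2 * ρ)) →
      ReachIn μ r S (K * ((n - 1) ^ 2 * (L + 1))) x
        (fun y => ∃ f : Fin n → Fin n, (∀ i ∈ S, f i ∈ S) ∧ Clustered r S f y) := by
  induction K using Nat.strong_induction_on with
  | _ K ih =>
  intro S x hx
  by_cases hsmall : ∀ i ∈ S, ∀ j ∈ S, x i - x j ≤ ρ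
  · exact ReachIn.refl (clustered_of_abs_le (fun i _ => hρ i) hsmall)
  have hμ0 : 0 ≤ μ := by linarith
  set δ := (1 - μ) ^ 2 * ρ with hδ
  have hδ0 : 0 < δ := mul_pos (pow_pos (by linarith) 2) hρ0
  have hδ4 : 4 * δ ≤ ρ := by
    have : (1 - μ) ^ 2 ≤ 1 / 4 := by nlinarith
    nlinarith
  obtain _ | K := K
  · exact absurd (by simpa using hx) hsmall
  push Not at hsmall
  obtain ⟨i₀, hi₀, j₀, hj₀, hij⟩ := hsmall
  have hne : S.Nonempty := ⟨i₀, hi₀⟩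
  obtain ⟨ia, hia, ha⟩ := S.exists_min_image (fun i => x i) hne
  obtain ⟨ib, hib, hb⟩ := S.exists_max_image (fun i => x i) hne
  -- With the largest radius in `S`, a gap longer than `r M` is out of reach for all of `S`.
  obtain ⟨M, hM, hMmax⟩ := S.exists_max_image r hne
  have hxab : ∀ i ∈ S, x i ∈ Set.Icc (x ia) (x ib) := fun i hi => ⟨ha i hi, hb i hi⟩
  have hD := hx ib hib ia hia
  push_cast at hD
  have hround := (reachIn_progress hμ hμ1 hM hρ0 (fun i _ => hρ i) (hL M)
    (by linarith [ha j₀ hj₀, hb i₀ hi₀]) hxab ⟨ia, hia, rfl⟩ ⟨ib, hib, rfl⟩).and_mem_Icc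
      hμ0 hμ1.le hxab
  rw [add_mul, one_mul, add_comm]
  refine hround.trans ?_
  rintro y ⟨⟨u, v, huv, ⟨iu, hiu, hyu⟩, ⟨iv, hiv, hyv⟩, hsplit⟩ | hprog | hprog, hy⟩
  · have hRρ := hρ M
    set S₁ := S.filter fun i => y i ≤ u
    set S₂ := S.filter fun i => ¬ y i ≤ u
    have hS : S₁ ∪ S₂ = S := Finset.filter_union_filter_not_eq _ _
    have hd : Disjoint S₁ S₂ := Finset.disjoint_filter_filter_not _ _ _
    have h₁ : ∀ i ∈ S₁, y i ∈ Set.Icc (x ia) u := fun i hi => by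
      obtain ⟨hi, hi'⟩ := Finset.mem_filter.1 hi
      exact ⟨(hy i hi).1, hi'⟩
    have h₂ : ∀ i ∈ S₂, y i ∈ Set.Icc v (x ib) := fun i hi => by
      obtain ⟨hi, hi'⟩ := Finset.mem_filter.1 hi
      exact ⟨(hsplit i hi).resolve_left hi', (hy i hi).2⟩
    have hau := (hy iu hiu).1.trans hyu
    have hvb := hyv.trans (hy iv hiv).2
    have hc₁ := Nat.le_ceil ((u - x ia - ρ) / δ)
    have hc₂ := Nat.le_ceil ((x ib - v - ρ) / δ)
    -- Each part has its own allowance `ρ` and the gap removes more than `ρ`; as `ρ ≥ 4δ`, the two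
    -- parts together fit into the remaining `K` rounds.
    have hK : ⌈(u - x ia - ρ) / δ⌉₊ + ⌈(x ib - v - ρ) / δ⌉₊ ≤ K := by
      apply ceil_add_ceil_le
      · rw [div_le_iff₀ hδ0]; linarith
      · rw [div_le_iff₀ hδ0]; linarith
      · rw [← add_div, div_le_iff₀ hδ0]; linarith
    set K₁ := ⌈(u - x ia - ρ) / δ⌉₊
    set K₂ := ⌈(x ib - v - ρ) / δ⌉₊
    rw [div_le_iff₀ hδ0] at hc₁ hc₂
    have r₁ := ((ih K₁ (by omega) S₁ y fun i hi j hj => by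
      linarith [(h₁ i hi).2, (h₁ j hj).1]).and_mem_Icc hμ0 hμ1.le h₁).and_eq_of_notMem
    refine ((r₁.mono (Finset.filter_subset _ _) le_rfl fun _ h => h).trans
      (m' := K₂ * ((n - 1) ^ 2 * (L + 1))) ?_).mono subset_rfl
        (by rw [← add_mul]; exact Nat.mul_le_mul_right _ hK) fun _ h => h
    rintro z ⟨⟨⟨f₁, hf₁, hz₁⟩, hz₁'⟩, hz⟩
    have hz₂ : ∀ i ∈ S₂, z i = y i := fun i hi =>
      hz i fun hi' => Finset.disjoint_left.1 hd hi' hi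
    have r₂ := ((ih K₂ (by omega) S₂ z fun i hi j hj => by
      rw [hz₂ i hi, hz₂ j hj]
      linarith [(h₂ i hi).2, (h₂ j hj).1]).and_mem_Icc hμ0 hμ1.le
        (fun i hi => by rw [hz₂ i hi]; exact h₂ i hi)).and_eq_of_notMem
    refine r₂.mono (Finset.filter_subset _ _) le_rfl ?_
    rintro w ⟨⟨⟨f₂, hf₂, hw₂⟩, hw₂'⟩, hw⟩
    have hw₁ : ∀ i ∈ S₁, w i = z i := fun i hi =>
      hw i fun hi' => Finset.disjoint_left.1 hd hi hi'
    refine ⟨fun i => if i ∈ S₁ then f₁ i else f₂ i, fun i hi => ?_, ?_⟩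
    · rw [← hS] at hi ⊢
      beta_reduce
      split_ifs with hi'
      · exact Finset.mem_union_left _ (hf₁ i hi')
      · exact Finset.mem_union_right _ (hf₂ i ((Finset.mem_union.1 hi).resolve_left hi'))
    · rw [← hS]
      refine (hz₁.congr hw₁).union hw₂ hf₁ hf₂ hd (R := r M)
        (fun i hi => hMmax i (hS ▸ hi)) fun i hi j hj => ?_
      rw [hw₁ i hi]
      linarith [(hz₁' i hi).2, (hw₂' j hj).1]
  · exact ih K (by omega) S y fun i hi j hj => by linarith [hprog j hj, (hy i hi).2]
  · exact ih K (by omega) S y fun i hi j hj => by linarith [hprog i hi, (hy j hj).1]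

end Control

/-! ### Dynamics and contraction inside clusters -/

section Clusters

variable {n : ℕ} {μ : ℝ} {r : Fin n → ℝ} {f : Fin n → Fin n} {x : EuclideanSpace ℝ (Fin n)}

/-- Classes occupy disjoint, ordered intervals: a class reaching past a foreign agent would be wider
than a radius of its own. -/
theorem Clustered.lt_of_lt (h : Clustered r Finset.univ f x) {i j i' j' : Fin n} (hij : f i ≠ f j)
    (hx : x i < x j) (hi : f i' = f i) (hj : f j' = f j) : x i' < x j' := by
  have h₁ : x i' < x j := by
    by_contra! hc
    have a := (h i (by simp) i' (by simp)).1 hi.symm i (by simp) rfl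
    have b := (h i (by simp) j (by simp)).2 hij i (by simp) rfl
    rw [abs_sub_comm, abs_of_nonneg (by linarith)] at a b
    linarith
  by_contra! hc
  have a := (h j (by simp) j' (by simp)).1 hj.symm j (by simp) rfl
  have b := (h j (by simp) i' (by simp)).2 (by rw [hi]; exact hij.symm) j (by simp) rfl
  rw [abs_of_nonneg (by linarith)] at a b
  linarith

theorem Clustered.add_lt (h : Clustered r Finset.univ f x) {i j i' j' k : Fin n} (hij : f i ≠ f j)
    (hx : x i < x j) (hi : f i' = f i) (hj : f j' = f j) (hk : f k = f i ∨ f k = f j) :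
    x i' + r k < x j' := by
  have hlt := h.lt_of_lt hij hx hi hj
  rcases hk with hk | hk
  · have b := (h i' (by simp) j' (by simp)).2 (by rwa [hi, hj]) k (by simp) (hk.trans hi.symm)
    rw [abs_sub_comm, abs_of_pos (by linarith)] at b
    linarith
  · have b := (h j' (by simp) i' (by simp)).2 (by rw [hi, hj]; exact hij.symm) k (by simp)
      (hk.trans hj.symm)
    rw [abs_of_pos (by linarith)] at b
    linarith

theorem exists_label_bounds (f : Fin n → Fin n) (x : EuclideanSpace ℝ (Fin n)) (i : Fin n) :
    ∃ a b, f a = f i ∧ f b = f i ∧ ∀ k, f k = f i → x k ∈ Set.Icc (x a) (x b) := by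
  have hne : (Finset.univ.filter fun k => f k = f i).Nonempty := ⟨i, by simp⟩
  obtain ⟨a, ha, ha'⟩ := Finset.exists_min_image _ (fun k => x k) hne
  obtain ⟨b, hb, hb'⟩ := Finset.exists_max_image _ (fun k => x k) hne
  refine ⟨a, b, by simpa using ha, by simpa using hb, fun k hk => ⟨ha' k ?_, hb' k ?_⟩⟩ <;>
    simpa using hk

/-- Hearing coincides with having the same label, so it is mutual and the update is an exchange of
equal and opposite amounts. -/
theorem Clustered.dwStep_apply (h : Clustered r Finset.univ f x) (p : AgentPair n) (k : Fin n) :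
    dwStep μ r x p k = x k + (if f p.1.1 = f p.1.2 then μ * (x p.1.2 - x p.1.1) else 0) *
      ((if k = p.1.1 then 1 else 0) - if k = p.1.2 then 1 else 0) := by
  have hne : p.1.1 ≠ p.1.2 := p.2.ne
  have c : ∀ i j, |x j - x i| ≤ r i ↔ f i = f j := by
    intro i j
    rw [abs_sub_comm]
    constructor
    · intro hr
      by_contra hf
      exact absurd hr (not_le.2 ((h i (by simp) j (by simp)).2 hf i (by simp) rfl))
    · intro hf
      exact (h i (by simp) j (by simp)).1 hf i (by simp) rfl
  by_cases h₁ : k = p.1.1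
  · subst h₁
    rw [dwStep_apply_fst]
    simp [hne, c]
  by_cases h₂ : k = p.1.2
  · subst h₂
    rw [dwStep_apply_snd]
    simp only [c, if_neg hne.symm, if_true, eq_comm (a := f p.1.2)]
    split_ifs <;> ring
  · rw [dwStep_apply_of_ne _ _ _ _ h₁ h₂]
    simp [h₁, h₂]

theorem Clustered.dwStep_mem_Icc (h : Clustered r Finset.univ f x) (hμ0 : 0 ≤ μ) (hμ1 : μ ≤ 1)
    (p : AgentPair n) {i : Fin n} {a b : ℝ} (hx : ∀ k, f k = f i → x k ∈ Set.Icc a b) :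
    ∀ k, f k = f i → dwStep μ r x p k ∈ Set.Icc a b := by
  intro k hk
  by_cases hf : f p.1.1 = f p.1.2
  · by_cases hp : f p.1.1 = f i
    · refine _root_.dwStep_mem_Icc hμ0 hμ1 (S := Finset.univ.filter fun k => f k = f i)
        (fun j hj => hx j (by simpa using hj)) ?_ ?_ k ?_ <;> simp [hk, hp, ← hf]
    · rw [dwStep_apply_of_ne _ _ _ _ (by rintro rfl; exact hp hk)
        (by rintro rfl; exact hp (hf.trans hk))]
      exact hx k hk
  · rw [h.dwStep_apply, if_neg hf, zero_mul, add_zero]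
    exact hx k hk

/-- The hull of each class can only shrink, so distances within a class stay small and gaps between
classes stay large. -/
theorem Clustered.clustered_dwStep (h : Clustered r Finset.univ f x) (hr : ∀ i, 0 < r i) (hμ0 : 0 ≤ μ)
    (hμ1 : μ ≤ 1) (p : AgentPair n) : Clustered r Finset.univ f (dwStep μ r x p) := by
  have sep : ∀ i j k, f i ≠ f j → x i < x j → (f k = f i ∨ f k = f j) →
      r k < dwStep μ r x p j - dwStep μ r x p i := by
    intro i j k hij hx hk
    obtain ⟨a, b, ha, hb, hab⟩ := exists_label_bounds f x i
    obtain ⟨a', b', ha', hb', hab'⟩ := exists_label_bounds f x j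
    have h₁ := h.dwStep_mem_Icc hμ0 hμ1 p hab i rfl
    have h₂ := h.dwStep_mem_Icc hμ0 hμ1 p hab' j rfl
    have h₃ := h.add_lt hij hx hb ha' hk
    linarith [h₁.2, h₂.1]
  intro i _ j _
  constructor
  · intro hij k _ hk
    obtain ⟨a, b, ha, hb, hab⟩ := exists_label_bounds f x i
    have h₁ := h.dwStep_mem_Icc hμ0 hμ1 p hab i rfl
    have h₂ := h.dwStep_mem_Icc hμ0 hμ1 p hab j hij.symm
    have h₃ := (h b (by simp) a (by simp)).1 (hb.trans ha.symm) k (by simp) (hk.trans hb.symm)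
    have h₄ := (le_abs_self _).trans h₃
    exact abs_le.2 ⟨by linarith [h₁.1, h₂.2], by linarith [h₁.2, h₂.1]⟩
  · intro hij k _ hk
    have h₀ : 0 < |x i - x j| := (hr i).trans ((h i (by simp) j (by simp)).2 hij i (by simp) rfl)
    rcases lt_or_gt_of_ne (sub_ne_zero.1 (abs_pos.1 h₀)) with hlt | hlt
    · rw [abs_sub_comm]
      exact (sep i j k hij hlt (Or.inl hk)).trans_le (le_abs_self _)
    · exact (sep j i k hij.symm hlt (Or.inr hk)).trans_le (le_abs_self _)

/-- The agents heard by `i` in the state `x`. -/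
noncomputable def heard (r : Fin n → ℝ) (x : EuclideanSpace ℝ (Fin n)) (i : Fin n) : Finset (Fin n) :=
  Finset.univ.filter fun j => |x i - x j| ≤ r i

/-- The vector whose `i`-th entry is the mean opinion of the agents heard by `i`. -/
noncomputable def heardMean (r : Fin n → ℝ) (x : EuclideanSpace ℝ (Fin n)) :
    EuclideanSpace ℝ (Fin n) :=
  WithLp.toLp 2 fun i => (∑ j ∈ heard r x i, x j) / (heard r x i).card

/-- Identifies the label-free mean with the class mean; the label-free form is what makes
measurability easy. -/
theorem Clustered.heard_eq (h : Clustered r Finset.univ f x) (i : Fin n) :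
    heard r x i = Finset.univ.filter fun j => f j = f i := by
  ext j
  simp only [heard, Finset.mem_filter, Finset.mem_univ, true_and]
  constructor
  · intro hr
    by_contra hf
    exact absurd hr
      (not_le.2 ((h i (by simp) j (by simp)).2 (fun e => hf e.symm) i (by simp) rfl))
  · intro hf
    exact (h i (by simp) j (by simp)).1 hf.symm i (by simp) rfl

theorem Clustered.heardMean_apply (h : Clustered r Finset.univ f x) (i : Fin n) :
    heardMean r x i = (∑ j with f j = f i, x j) /
      ((Finset.univ.filter fun j => f j = f i).card : ℝ) := by
  simp only [heardMean, h.heard_eq]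

theorem Clustered.heardMean_eq (h : Clustered r Finset.univ f x) {i j : Fin n} (hij : f i = f j) :
    heardMean r x i = heardMean r x j := by
  rw [h.heardMean_apply, h.heardMean_apply, hij]

theorem card_label_pos (f : Fin n → Fin n) (i : Fin n) :
    0 < ((Finset.univ.filter fun j => f j = f i).card : ℝ) := by
  exact_mod_cast Finset.card_pos.2 ⟨i, by simp⟩

theorem Clustered.heardMean_mem_Icc (h : Clustered r Finset.univ f x) {i : Fin n} {a b : ℝ}
    (hx : ∀ k, f k = f i → x k ∈ Set.Icc a b) : heardMean r x i ∈ Set.Icc a b := by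
  have hc := card_label_pos f i
  rw [h.heardMean_apply, Set.mem_Icc, le_div_iff₀ hc, div_le_iff₀ hc, mul_comm a, mul_comm b,
    ← nsmul_eq_mul, ← nsmul_eq_mul]
  exact ⟨Finset.card_nsmul_le_sum _ _ _ fun k hk => (hx k (by simpa using hk)).1,
    Finset.sum_le_card_nsmul _ _ _ fun k hk => (hx k (by simpa using hk)).2⟩

theorem Clustered.heardMean_separated (h : Clustered r Finset.univ f x) (hr : ∀ i, 0 < r i)
    (i j : Fin n) : heardMean r x i = heardMean r x j ∨
      max (r i) (r j) < |heardMean r x i - heardMean r x j| := by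
  have sep : ∀ i j k, f i ≠ f j → x i < x j → (f k = f i ∨ f k = f j) →
      r k < heardMean r x j - heardMean r x i := by
    intro i j k hij hx hk
    obtain ⟨a, b, ha, hb, hab⟩ := exists_label_bounds f x i
    obtain ⟨a', b', ha', hb', hab'⟩ := exists_label_bounds f x j
    have h₁ := h.heardMean_mem_Icc hab
    have h₂ := h.heardMean_mem_Icc hab'
    have h₃ := h.add_lt hij hx hb ha' hk
    linarith [h₁.2, h₂.1]
  by_cases hij : f i = f j
  · exact Or.inl (h.heardMean_eq hij)
  right
  have h₀ : 0 < |x i - x j| := (hr i).trans ((h i (by simp) j (by simp)).2 hij i (by simp) rfl)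
  rcases lt_or_gt_of_ne (sub_ne_zero.1 (abs_pos.1 h₀)) with hlt | hlt
  · rw [abs_sub_comm]
    exact (max_lt (sep i j i hij hlt (Or.inl rfl)) (sep i j j hij hlt (Or.inr rfl))).trans_le
      (le_abs_self _)
  · exact (max_lt (sep j i i (Ne.symm hij) hlt (Or.inr rfl))
      (sep j i j (Ne.symm hij) hlt (Or.inl rfl))).trans_le (le_abs_self _)

theorem Clustered.sum_mul_dwStep (h : Clustered r Finset.univ f x) (p : AgentPair n)
    {w : Fin n → ℝ} (hw : ∀ i j, f i = f j → w i = w j) :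
    ∑ k, w k * dwStep μ r x p k = ∑ k, w k * x k := by
  simp only [h.dwStep_apply, mul_add, Finset.sum_add_distrib]
  rw [add_eq_left]
  split_ifs with hf
  · have : ∀ k, w k * (μ * (x p.1.2 - x p.1.1) *
        ((if k = p.1.1 then 1 else 0) - if k = p.1.2 then 1 else 0)) =
        (if k = p.1.1 then w k * (μ * (x p.1.2 - x p.1.1)) else 0) -
        if k = p.1.2 then w k * (μ * (x p.1.2 - x p.1.1)) else 0 := by
      intro k
      split_ifs <;> ring
    simp only [this, Finset.sum_sub_distrib, Finset.sum_ite_eq', Finset.mem_univ, if_true,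
      hw _ _ hf, sub_self]
  · simp

theorem Clustered.heardMean_dwStep (h : Clustered r Finset.univ f x) (hr : ∀ i, 0 < r i)
    (hμ0 : 0 ≤ μ) (hμ1 : μ ≤ 1) (p : AgentPair n) :
    heardMean r (dwStep μ r x p) = heardMean r x := by
  ext i
  rw [(h.clustered_dwStep hr hμ0 hμ1 p).heardMean_apply, h.heardMean_apply]
  have := h.sum_mul_dwStep (μ := μ) p (w := fun k => if f k = f i then 1 else 0)
    (fun a b hab => by simp only [hab])
  simp only [ite_mul, one_mul, zero_mul, ← Finset.sum_filter] at this
  rw [this]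

/-- Deviations from class means are orthogonal to every vector constant on classes. -/
theorem Clustered.sum_mul_sub_heardMean (h : Clustered r Finset.univ f x)
    {w : Fin n → ℝ} (hw : ∀ i j, f i = f j → w i = w j) :
    ∑ k, w k * (x k - heardMean r x k) = 0 := by
  simp only [mul_sub, Finset.sum_sub_distrib, h.heardMean_apply]
  rw [sub_eq_zero]
  symm
  calc ∑ k, w k * ((∑ j with f j = f k, x j) / ((Finset.univ.filter fun j => f j = f k).card : ℝ))
      = ∑ k, ∑ j, if f j = f k then
          w k * x j / ((Finset.univ.filter fun j => f j = f k).card : ℝ) else 0 := by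
        refine Finset.sum_congr rfl fun k _ => ?_
        rw [← Finset.sum_filter, mul_div_assoc', Finset.mul_sum, Finset.sum_div]
    _ = ∑ j, ∑ k, if f k = f j then
          w j * x j / ((Finset.univ.filter fun l => f l = f j).card : ℝ) else 0 := by
        rw [Finset.sum_comm]
        refine Finset.sum_congr rfl fun j _ => Finset.sum_congr rfl fun k _ => ?_
        by_cases hjk : f j = f k
        · rw [if_pos hjk, if_pos hjk.symm, hw k j hjk.symm, hjk]
        · rw [if_neg hjk, if_neg (Ne.symm hjk)]
    _ = ∑ j, w j * x j := by
        refine Finset.sum_congr rfl fun j _ => ?_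
        have := card_label_pos f j
        rw [← Finset.sum_filter, Finset.sum_const, nsmul_eq_mul]
        field_simp

/-- The squared distance to the vector of means of the agents heard. -/
noncomputable def dispersion (r : Fin n → ℝ) (x : EuclideanSpace ℝ (Fin n)) : ℝ :=
  ‖x - heardMean r x‖ ^ 2

theorem dispersion_eq_sum (r : Fin n → ℝ) (x : EuclideanSpace ℝ (Fin n)) :
    dispersion r x = ∑ k, (x k - heardMean r x k) ^ 2 := by
  simp [dispersion, EuclideanSpace.norm_sq_eq]

/-- By Pythagoras, replacing class means by the constant `1 / 2` can only increase the sum of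
squares, and each term is then at most `1 / 4`. -/
theorem Clustered.dispersion_le (h : Clustered r Finset.univ f x)
    (hx : ∀ i, x i ∈ Set.Icc (0 : ℝ) 1) : dispersion r x ≤ n / 4 := by
  have h₀ := h.sum_mul_sub_heardMean (w := fun k => heardMean r x k - 1 / 2)
    (fun i j hij => by simp only [h.heardMean_eq hij])
  calc dispersion r x
      ≤ ∑ k, ((x k - 1 / 2) ^ 2 - 2 * ((heardMean r x k - 1 / 2) * (x k - heardMean r x k))) := by
        rw [dispersion_eq_sum]
        exact Finset.sum_le_sum fun k _ => by nlinarith [sq_nonneg (heardMean r x k - 1 / 2)]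
    _ = ∑ k, (x k - 1 / 2) ^ 2 := by
        rw [Finset.sum_sub_distrib, ← Finset.mul_sum, h₀, mul_zero, sub_zero]
    _ ≤ ∑ _k : Fin n, (1 / 4 : ℝ) :=
        Finset.sum_le_sum fun k _ => by nlinarith [(hx k).1, (hx k).2]
    _ = n / 4 := by simp; ring

theorem Clustered.dispersion_dwStep (h : Clustered r Finset.univ f x) (hr : ∀ i, 0 < r i)
    (hμ0 : 0 ≤ μ) (hμ1 : μ ≤ 1) (p : AgentPair n) :
    dispersion r (dwStep μ r x p) = dispersion r x -
      2 * μ * (1 - μ) * (if f p.1.1 = f p.1.2 then (x p.1.1 - x p.1.2) ^ 2 else 0) := by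
  have hne : p.1.1 ≠ p.1.2 := p.2.ne
  rw [dispersion_eq_sum, dispersion_eq_sum, h.heardMean_dwStep hr hμ0 hμ1]
  simp only [h.dwStep_apply]
  split_ifs with hf
  swap
  · simp
  set d := μ * (x p.1.2 - x p.1.1) with hd
  have hm := h.heardMean_eq hf
  have : ∀ k, (x k + d * ((if k = p.1.1 then 1 else 0) - if k = p.1.2 then 1 else 0) -
        heardMean r x k) ^ 2 = (x k - heardMean r x k) ^ 2 +
        (if k = p.1.1 then 2 * d * (x k - heardMean r x k) + d ^ 2 else 0) +
        (if k = p.1.2 then -2 * d * (x k - heardMean r x k) + d ^ 2 else 0) := by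
    intro k
    by_cases h₁ : k = p.1.1
    · have h₂ : k ≠ p.1.2 := fun e => hne (h₁.symm.trans e)
      simp only [h₁, if_true, if_neg hne]; ring
    · simp only [if_neg h₁]
      split_ifs <;> ring
  simp only [this, Finset.sum_add_distrib, Finset.sum_ite_eq', Finset.mem_univ, if_true, hm]
  rw [hd]
  ring

theorem sum_sum_eq_two_mul_sum_agentPair {g : Fin n → Fin n → ℝ} (hg : ∀ i j, g i j = g j i)
    (hg0 : ∀ i, g i i = 0) : ∑ i, ∑ j, g i j = 2 * ∑ p : AgentPair n, g p.1.1 p.1.2 := by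
  have h₁ : ∑ p : AgentPair n, g p.1.1 p.1.2 = ∑ i, ∑ j, if i < j then g i j else 0 := by
    rw [← Finset.sum_product', ← Finset.sum_filter]
    exact (Finset.sum_subtype _ (p := fun q : Fin n × Fin n => q.1 < q.2) (by simp)
      (fun q : Fin n × Fin n => g q.1 q.2)).symm
  have h₂ : ∑ i, ∑ j, (if i < j then g i j else 0) = ∑ i, ∑ j, if j < i then g i j else 0 := by
    rw [Finset.sum_comm]
    exact Finset.sum_congr rfl fun i _ => Finset.sum_congr rfl fun j _ => by rw [hg]
  rw [two_mul, h₁]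
  nth_rw 2 [h₂]
  simp only [← Finset.sum_add_distrib]
  refine Finset.sum_congr rfl fun i _ => Finset.sum_congr rfl fun j _ => ?_
  rcases lt_trichotomy i j with hij | rfl | hij
  · simp [hij, hij.not_gt]
  · simp [hg0]
  · simp [hij, hij.not_gt]

theorem card_agentPair (n : ℕ) : 2 * (Fintype.card (AgentPair n) : ℝ) = n * (n - 1) := by
  have h := sum_sum_eq_two_mul_sum_agentPair (n := n) (g := fun i j => if i = j then 0 else 1)
    (fun i j => by simp only [eq_comm]) (by simp)
  have h' : ∑ p : AgentPair n, (if p.1.1 = p.1.2 then (0 : ℝ) else 1) =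
      Fintype.card (AgentPair n) := by
    rw [Finset.sum_congr rfl fun p _ => if_neg (p.2.ne : p.1.1 ≠ p.1.2)]
    simp
  rw [← h', ← h]
  have : ∀ i : Fin n, ∑ j, (if i = j then (0 : ℝ) else 1) = n - 1 := by
    intro i
    have : ∀ j, (if i = j then (0 : ℝ) else 1) = 1 - if i = j then 1 else 0 := by
      intro j; split_ifs <;> ring
    simp [this, Finset.sum_sub_distrib]
  simp [this]
  ring

/-- In a class of size `c` the squared differences over pairs sum to `c` times the dispersion.
Singletons have no dispersion, so `c ≥ 2` wherever it matters. -/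
theorem Clustered.two_mul_dispersion_le (h : Clustered r Finset.univ f x) :
    2 * dispersion r x ≤
      ∑ p : AgentPair n, if f p.1.1 = f p.1.2 then (x p.1.1 - x p.1.2) ^ 2 else 0 := by
  have hs := sum_sum_eq_two_mul_sum_agentPair (n := n)
    (g := fun i j => if f i = f j then (x i - x j) ^ 2 else 0)
    (fun i j => by simp only [eq_comm (a := f i)]; split_ifs <;> ring) (by simp)
  set z : Fin n → ℝ := fun k => x k - heardMean r x k with hz
  set c : Fin n → ℝ := fun i => ((Finset.univ.filter fun j => f j = f i).card : ℝ) with hc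
  have hzero : ∀ i, ∑ j, (if f i = f j then z j else 0) = 0 := by
    intro i
    have := h.sum_mul_sub_heardMean (w := fun k => if f i = f k then 1 else 0)
      (fun a b hab => by simp only [hab])
    simpa only [ite_mul, one_mul, zero_mul] using this
  have hcard : ∀ i, ∑ j, (if f i = f j then (1 : ℝ) else 0) = c i := by
    intro i
    simp [hc, eq_comm]
  have hrow : ∀ i, ∑ j, (if f i = f j then (x i - x j) ^ 2 else 0) =
      c i * z i ^ 2 + ∑ j, if f i = f j then z j ^ 2 else 0 := by
    intro i
    have : ∀ j, (if f i = f j then (x i - x j) ^ 2 else 0) =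
        (if f i = f j then 1 else 0) * z i ^ 2 - 2 * z i * (if f i = f j then z j else 0) +
          if f i = f j then z j ^ 2 else 0 := by
      intro j
      split_ifs with hij
      · simp only [hz, h.heardMean_eq hij]; ring
      · ring
    simp only [this, Finset.sum_add_distrib, Finset.sum_sub_distrib, ← Finset.sum_mul,
      ← Finset.mul_sum, hzero, hcard, mul_zero, sub_zero]
  have hcol : ∑ i, ∑ j, (if f i = f j then z j ^ 2 else 0) = ∑ j, c j * z j ^ 2 := by
    rw [Finset.sum_comm]
    refine Finset.sum_congr rfl fun j _ => ?_
    rw [← hcard j, Finset.sum_mul]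
    refine Finset.sum_congr rfl fun i _ => ?_
    simp only [eq_comm (a := f i)]
    split_ifs <;> ring
  simp only [hrow, Finset.sum_add_distrib, hcol] at hs
  have hterm : ∀ i, 2 * z i ^ 2 ≤ c i * z i ^ 2 := by
    intro i
    by_cases hone : (Finset.univ.filter fun j => f j = f i).card ≤ 1
    · have : z i = 0 := by
        have h0 := hzero i
        rw [← Finset.sum_filter, Finset.sum_eq_single_of_mem i (by simp)] at h0
        · exact h0
        · intro b hb hbi
          have hb' : f b = f i := by simpa [eq_comm] using hb
          exact absurd (Finset.card_le_one.1 hone b (by simpa using hb') i (by simp)) hbi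
      simp [this]
    · have : (2 : ℝ) ≤ c i := by
        simp only [hc]
        exact_mod_cast (by omega : 2 ≤ (Finset.univ.filter fun j => f j = f i).card)
      exact mul_le_mul_of_nonneg_right this (sq_nonneg _)
  have hsum := Finset.sum_le_sum fun i (_ : i ∈ Finset.univ) => hterm i
  rw [← Finset.mul_sum] at hsum
  rw [dispersion_eq_sum]
  change 2 * ∑ k, z k ^ 2 ≤ _
  linarith

/-- One uniformly random update contracts the dispersion of a clustered state. -/
theorem Clustered.sum_dispersion_dwStep_le (h : Clustered r Finset.univ f x) (hr : ∀ i, 0 < r i)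
    (hμ0 : 0 ≤ μ) (hμ1 : μ ≤ 1) :
    ∑ p : AgentPair n, dispersion r (dwStep μ r x p) ≤
      (Fintype.card (AgentPair n) - 4 * μ * (1 - μ)) * dispersion r x := by
  simp only [h.dispersion_dwStep hr hμ0 hμ1, Finset.sum_sub_distrib, ← Finset.mul_sum]
  have h₁ := h.two_mul_dispersion_le
  have h₂ : 0 ≤ 2 * μ * (1 - μ) := by nlinarith
  have h₃ := mul_le_mul_of_nonneg_left h₁ h₂
  simp only [Finset.sum_const, Finset.card_univ, nsmul_eq_mul]
  linarith

theorem Clustered.dispersion_dwStep_le (h : Clustered r Finset.univ f x) (hr : ∀ i, 0 < r i)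
    (hμ0 : 0 ≤ μ) (hμ1 : μ ≤ 1) (p : AgentPair n) :
    dispersion r (dwStep μ r x p) ≤ dispersion r x := by
  rw [h.dispersion_dwStep hr hμ0 hμ1, sub_le_self_iff]
  have : 0 ≤ 2 * μ * (1 - μ) := by nlinarith
  refine mul_nonneg this ?_
  split_ifs <;> positivity

end Clusters

/-! ### One-step averages of the unsettled indicator and the dispersion -/

section Chain

variable {n : ℕ} {μ : ℝ} {r : Fin n → ℝ}

/-- States in the unit cube that split into clusters out of reach of one another. -/
def settled (r : Fin n → ℝ) : Set (EuclideanSpace ℝ (Fin n)) :=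
  {x | (∀ i, x i ∈ Set.Icc (0 : ℝ) 1) ∧ ∃ f, Clustered r Finset.univ f x}

theorem measurableSet_settled (r : Fin n → ℝ) : MeasurableSet (settled r) := by
  have hco : ∀ i : Fin n, Measurable fun x : EuclideanSpace ℝ (Fin n) => x i := fun i => by fun_prop
  have habs : ∀ i j : Fin n, Measurable fun x : EuclideanSpace ℝ (Fin n) => |x i - x j| :=
    fun i j => ((hco i).sub (hco j)).abs
  refine measurableSet_setOfPred.2 (Measurable.and ?_ ?_)
  · exact Measurable.forall fun i => measurableSet_setOfPred.1 (hco i measurableSet_Icc)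
  · refine Measurable.exists fun f => ?_
    unfold Clustered
    refine Measurable.forall fun i => Measurable.forall fun _ => Measurable.forall fun j =>
      Measurable.forall fun _ => Measurable.and ?_ ?_
    · refine Measurable.forall fun _ => Measurable.forall fun k => Measurable.forall fun _ =>
        Measurable.forall fun _ => ?_
      exact measurableSet_setOfPred.1 (measurableSet_le (habs i j) measurable_const)
    · refine Measurable.forall fun _ => Measurable.forall fun k => Measurable.forall fun _ =>
        Measurable.forall fun _ => ?_
      exact measurableSet_setOfPred.1 (measurableSet_lt measurable_const (habs i j))

theorem measurable_euclideanSpace_mk {α : Type*} [MeasurableSpace α]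
    {F : α → EuclideanSpace ℝ (Fin n)} (h : ∀ i, Measurable fun a => F a i) : Measurable F :=
  (WithLp.measurable_toLp 2 (Fin n → ℝ)).comp (measurable_pi_iff.2 h)

theorem measurable_heardMean (r : Fin n → ℝ) : Measurable (heardMean r) := by
  have hco : ∀ i : Fin n, Measurable fun x : EuclideanSpace ℝ (Fin n) => x i := fun i => by fun_prop
  refine measurable_euclideanSpace_mk fun i => ?_
  have hset : ∀ j, MeasurableSet {x : EuclideanSpace ℝ (Fin n) | |x i - x j| ≤ r i} := fun j =>
    measurableSet_le ((hco i).sub (hco j)).abs measurable_const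
  simp only [heardMean, heard, Finset.sum_filter, Finset.card_filter, Nat.cast_sum]
  refine (Finset.measurable_sum _ fun j _ => ?_).div (Finset.measurable_sum _ fun j _ => ?_)
  · exact Measurable.ite (hset j) (hco j) measurable_const
  · simp only [Nat.cast_ite]
    exact Measurable.ite (hset j) measurable_const measurable_const

theorem measurable_dwStep (μ : ℝ) (r : Fin n → ℝ) (p : AgentPair n) :
    Measurable fun x => dwStep μ r x p := by
  have hco : ∀ i : Fin n, Measurable fun x : EuclideanSpace ℝ (Fin n) => x i := fun i => by fun_prop
  have hset : ∀ i j k, MeasurableSet {x : EuclideanSpace ℝ (Fin n) | |x i - x j| ≤ r k} :=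
    fun i j k => measurableSet_le ((hco i).sub (hco j)).abs measurable_const
  refine measurable_euclideanSpace_mk fun k => ?_
  by_cases h₁ : k = p.1.1
  · subst h₁
    simp only [dwStep_apply_fst]
    exact (hco _).add (Measurable.ite (hset _ _ _)
      (((hco p.1.2).sub (hco p.1.1)).const_mul μ) measurable_const)
  by_cases h₂ : k = p.1.2
  · subst h₂
    simp only [dwStep_apply_snd]
    exact (hco _).add (Measurable.ite (hset _ _ _)
      (((hco p.1.1).sub (hco p.1.2)).const_mul μ) measurable_const)
  · simp only [dwStep_apply_of_ne _ _ _ _ h₁ h₂]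
    exact hco k

theorem settled_dwStep {x : EuclideanSpace ℝ (Fin n)} (hx : x ∈ settled r) (hr : ∀ i, 0 < r i)
    (hμ0 : 0 ≤ μ) (hμ1 : μ ≤ 1) (p : AgentPair n) : dwStep μ r x p ∈ settled r := by
  obtain ⟨h, f, hf⟩ := hx
  exact ⟨fun i => dwStep_mem_Icc hμ0 hμ1 (S := Finset.univ) (fun i _ => h i) (by simp) (by simp) i
    (by simp), f, hf.clustered_dwStep hr hμ0 hμ1 p⟩

/-- The expectation of `g` after one update of the state `x` with a uniformly random pair. -/
noncomputable def stepMean (μ : ℝ) (r : Fin n → ℝ) (g : EuclideanSpace ℝ (Fin n) → ℝ)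
    (x : EuclideanSpace ℝ (Fin n)) : ℝ :=
  (∑ p : AgentPair n, g (dwStep μ r x p)) / Fintype.card (AgentPair n)

theorem measurable_stepMean {g : EuclideanSpace ℝ (Fin n) → ℝ} (hg : Measurable g) :
    Measurable (stepMean μ r g) :=
  (Finset.measurable_sum _ fun p _ => hg.comp (measurable_dwStep μ r p)).div_const _

theorem stepMean_mem_Icc [Nonempty (AgentPair n)] {g : EuclideanSpace ℝ (Fin n) → ℝ} {a b : ℝ}
    (hg : ∀ x, g x ∈ Set.Icc a b) (x : EuclideanSpace ℝ (Fin n)) :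
    stepMean μ r g x ∈ Set.Icc a b := by
  have hc : (0 : ℝ) < Fintype.card (AgentPair n) := by exact_mod_cast Fintype.card_pos
  rw [stepMean, Set.mem_Icc, le_div_iff₀ hc, div_le_iff₀ hc, mul_comm a, mul_comm b,
    ← nsmul_eq_mul, ← nsmul_eq_mul]
  exact ⟨Finset.card_nsmul_le_sum _ _ _ fun k _ => (hg _).1,
    Finset.sum_le_card_nsmul _ _ _ fun k _ => (hg _).2⟩

/-- The indicator function of the states that are not settled. -/
noncomputable def unsettledInd (r : Fin n → ℝ) : EuclideanSpace ℝ (Fin n) → ℝ :=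
  (settled r)ᶜ.indicator 1

theorem unsettledInd_of_mem {x : EuclideanSpace ℝ (Fin n)} (hx : x ∈ settled r) :
    unsettledInd r x = 0 := by
  simp [unsettledInd, hx]

theorem unsettledInd_of_notMem {x : EuclideanSpace ℝ (Fin n)} (hx : x ∉ settled r) :
    unsettledInd r x = 1 := by
  simp [unsettledInd, hx]

theorem measurable_unsettledInd (r : Fin n → ℝ) : Measurable (unsettledInd r) :=
  measurable_one.indicator (measurableSet_settled r).compl

theorem unsettledInd_mem_Icc (x : EuclideanSpace ℝ (Fin n)) :
    unsettledInd r x ∈ Set.Icc (0 : ℝ) 1 := by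
  by_cases hx : x ∈ settled r
  · simp [unsettledInd_of_mem hx]
  · simp [unsettledInd_of_notMem hx]

theorem iterate_stepMean_mem_Icc [Nonempty (AgentPair n)] {g : EuclideanSpace ℝ (Fin n) → ℝ}
    {a b : ℝ} (hg : ∀ x, g x ∈ Set.Icc a b) (m : ℕ) :
    ∀ x, (stepMean μ r)^[m] g x ∈ Set.Icc a b := by
  induction m with
  | zero => exact hg
  | succ m ih => rw [Function.iterate_succ_apply']; exact stepMean_mem_Icc ih

theorem iterate_stepMean_of_mem (hr : ∀ i, 0 < r i) (hμ0 : 0 ≤ μ) (hμ1 : μ ≤ 1) (m : ℕ) :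
    ∀ x ∈ settled r, (stepMean μ r)^[m] (unsettledInd r) x = 0 := by
  induction m with
  | zero => exact fun x hx => unsettledInd_of_mem hx
  | succ m ih =>
    intro x hx
    rw [Function.iterate_succ_apply', stepMean,
      Finset.sum_eq_zero fun p _ => ih _ (settled_dwStep hx hr hμ0 hμ1 p), zero_div]

/-- The prescribed list is drawn with probability at least `N⁻ᵐ`; a shorter list suffices because
settled states are absorbing. -/
theorem iterate_stepMean_le_of_foldl_mem [Nonempty (AgentPair n)] (hr : ∀ i, 0 < r i)
    (hμ0 : 0 ≤ μ) (hμ1 : μ ≤ 1) (m : ℕ) :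
    ∀ (x : EuclideanSpace ℝ (Fin n)) (l : List (AgentPair n)), l.length ≤ m →
      l.foldl (dwStep μ r) x ∈ settled r →
      (stepMean μ r)^[m] (unsettledInd r) x ≤ 1 - (1 / Fintype.card (AgentPair n) : ℝ) ^ m := by
  have hN1 : (1 : ℝ) ≤ Fintype.card (AgentPair n) := by exact_mod_cast Fintype.card_pos
  have hN : (0 : ℝ) < Fintype.card (AgentPair n) := by linarith
  have hle : ∀ m, (1 / Fintype.card (AgentPair n) : ℝ) ^ m ≤ 1 := fun m =>
    pow_le_one₀ (by positivity) (by rw [div_le_one hN]; exact hN1)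
  have settled_case : ∀ m, ∀ x ∈ settled r,
      (stepMean μ r)^[m] (unsettledInd r) x ≤ 1 - (1 / Fintype.card (AgentPair n) : ℝ) ^ m := by
    intro m x hx
    rw [iterate_stepMean_of_mem hr hμ0 hμ1 m x hx]
    linarith [hle m]
  induction m with
  | zero =>
    intro x l hl hx
    rw [List.length_eq_zero_iff.1 (Nat.le_zero.1 hl)] at hx
    exact settled_case 0 x hx
  | succ m ih =>
    intro x l hl hx
    obtain _ | ⟨q, l⟩ := l
    · exact settled_case _ x hx
    have hq := ih (dwStep μ r x q) l (by simpa using hl) hx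
    rw [Function.iterate_succ_apply', stepMean, div_le_iff₀ hN]
    have hother : ∀ p ∈ Finset.univ.erase q,
        (stepMean μ r)^[m] (unsettledInd r) (dwStep μ r x p) ≤ 1 := fun p _ =>
      (iterate_stepMean_mem_Icc unsettledInd_mem_Icc m _).2
    have hsum := Finset.sum_le_card_nsmul _ _ _ hother
    rw [Finset.card_erase_of_mem (Finset.mem_univ q), nsmul_eq_mul, mul_one,
      Finset.card_univ, Nat.cast_sub Fintype.card_pos, Nat.cast_one] at hsum
    rw [← Finset.add_sum_erase _ _ (Finset.mem_univ q)]
    have : (1 - (1 / Fintype.card (AgentPair n) : ℝ) ^ (m + 1)) * Fintype.card (AgentPair n) =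
        Fintype.card (AgentPair n) - (1 / Fintype.card (AgentPair n) : ℝ) ^ m := by
      rw [pow_succ]
      field_simp
    rw [this]
    linarith

/-- The dispersion on settled states, extended by zero. -/
noncomputable def settledDispersion (r : Fin n → ℝ) : EuclideanSpace ℝ (Fin n) → ℝ :=
  (settled r).indicator (dispersion r)

theorem measurable_settledDispersion (r : Fin n → ℝ) : Measurable (settledDispersion r) :=
  (((measurable_id.sub (measurable_heardMean r)).norm).pow_const 2).indicator
    (measurableSet_settled r)

theorem settledDispersion_of_mem {x : EuclideanSpace ℝ (Fin n)} (hx : x ∈ settled r) :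
    settledDispersion r x = dispersion r x := Set.indicator_of_mem hx _

theorem settledDispersion_of_notMem {x : EuclideanSpace ℝ (Fin n)} (hx : x ∉ settled r) :
    settledDispersion r x = 0 := Set.indicator_of_notMem hx _

theorem dispersion_nonneg (r : Fin n → ℝ) (x : EuclideanSpace ℝ (Fin n)) : 0 ≤ dispersion r x :=
  sq_nonneg _

theorem settledDispersion_nonneg (x : EuclideanSpace ℝ (Fin n)) : 0 ≤ settledDispersion r x :=
  Set.indicator_nonneg (fun x _ => dispersion_nonneg r x) x

theorem settledDispersion_le (x : EuclideanSpace ℝ (Fin n)) :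
    settledDispersion r x ≤ n / 4 * (1 - unsettledInd r x) := by
  by_cases hx : x ∈ settled r
  · rw [settledDispersion_of_mem hx, unsettledInd_of_mem hx, sub_zero, mul_one]
    obtain ⟨h, f, hf⟩ := hx
    exact hf.dispersion_le h
  · rw [settledDispersion_of_notMem hx, unsettledInd_of_notMem hx, sub_self, mul_zero]

theorem settledDispersion_mem_Icc (x : EuclideanSpace ℝ (Fin n)) :
    settledDispersion r x ∈ Set.Icc (0 : ℝ) (n / 4) := by
  refine ⟨settledDispersion_nonneg x, (settledDispersion_le x).trans ?_⟩
  have h : (0 : ℝ) ≤ n / 4 := by positivity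
  nlinarith [(unsettledInd_mem_Icc (r := r) x).1]

/-- A settled state contracts. From an unsettled one, the dispersion created is at most `n / 4`
times the probability of settling, that is, the drop of the unsettled mass; these drops telescope
later. -/
theorem stepMean_settledDispersion_le [Nonempty (AgentPair n)] (hr : ∀ i, 0 < r i) (hμ0 : 0 ≤ μ)
    (hμ1 : μ ≤ 1) (x : EuclideanSpace ℝ (Fin n)) :
    stepMean μ r (settledDispersion r) x ≤
      (1 - 4 * μ * (1 - μ) / Fintype.card (AgentPair n)) * settledDispersion r x +
        n / 4 * (unsettledInd r x - stepMean μ r (unsettledInd r) x) := by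
  have hN : (0 : ℝ) < Fintype.card (AgentPair n) := by exact_mod_cast Fintype.card_pos
  by_cases hx : x ∈ settled r
  · have h₀ : stepMean μ r (unsettledInd r) x = 0 := iterate_stepMean_of_mem hr hμ0 hμ1 1 x hx
    rw [h₀, unsettledInd_of_mem hx, sub_self, mul_zero, add_zero, settledDispersion_of_mem hx,
      stepMean, div_le_iff₀ hN]
    simp only [fun p => settledDispersion_of_mem (settled_dwStep hx hr hμ0 hμ1 p)]
    obtain ⟨h, f, hf⟩ := hx
    refine (hf.sum_dispersion_dwStep_le hr hμ0 hμ1).trans_eq ?_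
    field_simp
  · rw [settledDispersion_of_notMem hx, unsettledInd_of_notMem hx, mul_zero, zero_add, stepMean,
      stepMean, div_le_iff₀ hN]
    have := Finset.sum_le_sum fun p (_ : p ∈ (Finset.univ : Finset (AgentPair n))) =>
      settledDispersion_le (r := r) (dwStep μ r x p)
    rw [← Finset.mul_sum, Finset.sum_sub_distrib, Finset.sum_const, Finset.card_univ,
      nsmul_eq_mul, mul_one] at this
    refine this.trans_eq ?_
    field_simp

theorem dwState_congr {x : EuclideanSpace ℝ (Fin n)} {e e' : ℕ → AgentPair n} {t : ℕ}
    (h : ∀ s < t, e s = e' s) : dwState μ r x e t = dwState μ r x e' t := by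
  induction t with
  | zero => rfl
  | succ t ih =>
    rw [dwState, dwState, ih fun s hs => h s (by omega), h t (by omega)]

theorem measurable_dwState (e : ℕ → AgentPair n) (t : ℕ) :
    Measurable fun x => dwState μ r x e t := by
  induction t with
  | zero => exact measurable_id
  | succ t ih => exact (measurable_dwStep μ r (e t)).comp ih

end Chain

/-! ### Independence and the Markov property -/

theorem ProbabilityTheory.IndepFun.prodMk_left {Ω α β γ : Type*} [MeasurableSpace Ω]
    [MeasurableSpace α] [MeasurableSpace β] [MeasurableSpace γ] {P : Measure Ω}
    [IsProbabilityMeasure P] {X : Ω → α} {A : Ω → β} {B : Ω → γ} (hX : Measurable X)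
    (hA : Measurable A) (hB : Measurable B) (h : IndepFun X (fun ω => (A ω, B ω)) P)
    (hAB : IndepFun A B P) : IndepFun (fun ω => (X ω, A ω)) B P := by
  have := Measure.isProbabilityMeasure_map (μ := P) hX.aemeasurable
  have := Measure.isProbabilityMeasure_map (μ := P) hA.aemeasurable
  have := Measure.isProbabilityMeasure_map (μ := P) hB.aemeasurable
  have hXA : IndepFun X A P := h.comp measurable_id measurable_fst
  rw [indepFun_iff_map_prod_eq_prod_map_map (hX.prodMk hA).aemeasurable hB.aemeasurable,
    (indepFun_iff_map_prod_eq_prod_map_map hX.aemeasurable hA.aemeasurable).1 hXA]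
  have h₁ := (indepFun_iff_map_prod_eq_prod_map_map hX.aemeasurable
    (hA.prodMk hB).aemeasurable).1 h
  rw [(indepFun_iff_map_prod_eq_prod_map_map hA.aemeasurable hB.aemeasurable).1 hAB,
    ← Measure.prodAssoc_prod] at h₁
  have h₂ := congrArg (Measure.map MeasurableEquiv.prodAssoc.symm) h₁
  rw [Measure.map_map (by fun_prop) (by fun_prop), Measure.map_map (by fun_prop) (by fun_prop),
    MeasurableEquiv.symm_comp_self, Measure.map_id] at h₂
  exact h₂

section ChainLaw

variable {n : ℕ} {μ : ℝ} {r : Fin n → ℝ} {Ω : Type*} [MeasurableSpace Ω] {P : Measure Ω}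
  [IsProbabilityMeasure P] {e : ℕ → Ω → AgentPair n} {x₀ : Ω → EuclideanSpace ℝ (Fin n)}

theorem measurable_dwState_comp (he : ∀ t, Measurable (e t)) (hx₀ : Measurable x₀) (t : ℕ) :
    Measurable fun ω => dwState μ r (x₀ ω) (fun s => e s ω) t := by
  induction t with
  | zero => exact hx₀
  | succ t ih =>
    have : Measurable fun q : EuclideanSpace ℝ (Fin n) × AgentPair n => dwStep μ r q.1 q.2 :=
      measurable_from_prod_countable_left (measurable_dwStep μ r)
    exact this.comp (ih.prodMk (he t))

theorem indepFun_dwState [Nonempty (AgentPair n)] (he : ∀ t, Measurable (e t))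
    (hindep : iIndepFun e P) (hx₀ : Measurable x₀)
    (hx₀indep : IndepFun x₀ (fun ω t => e t ω) P) (t : ℕ) :
    IndepFun (fun ω => dwState μ r (x₀ ω) (fun s => e s ω) t) (e t) P := by
  have hpast : Measurable fun ω (i : Finset.range t) => e i ω :=
    measurable_pi_iff.2 fun i => he i
  have h₁ : IndepFun (fun ω (i : Finset.range t) => e i ω) (e t) P :=
    (hindep.indepFun_finset (Finset.range t) {t} (by simp) he).comp measurable_id
      (measurable_pi_apply (⟨t, by simp⟩ : ({t} : Finset ℕ)))
  have h₂ : IndepFun x₀ (fun ω => ((fun i : Finset.range t => e i ω), e t ω)) P :=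
    hx₀indep.comp (ψ := fun s : ℕ → AgentPair n => ((fun i : Finset.range t => s i), s t))
      measurable_id (by fun_prop)
  have h₃ := IndepFun.prodMk_left hx₀ hpast (he t) h₂ h₁
  -- The state at time `t` depends on the start and the pairs before `t` only; the arbitrary pair at
  -- other times is never used.
  let φ : EuclideanSpace ℝ (Fin n) × (Finset.range t → AgentPair n) → EuclideanSpace ℝ (Fin n) :=
    fun q => dwState μ r q.1
      (fun s => if h : s ∈ Finset.range t then q.2 ⟨s, h⟩ else Classical.arbitrary _) t
  have hφ : Measurable φ := measurable_from_prod_countable_left fun l =>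
    measurable_dwState
      (fun s => if h : s ∈ Finset.range t then l ⟨s, h⟩ else Classical.arbitrary _) t
  have := h₃.comp hφ measurable_id
  refine this.congr (ae_of_all _ fun ω => ?_) (ae_of_all _ fun ω => rfl)
  exact dwState_congr fun s hs => by simp [hs]

/-- Split according to the value of `e t`, which is uniform and independent of the current state. -/
theorem integral_comp_dwState_succ [Nonempty (AgentPair n)] (he : ∀ t, Measurable (e t))
    (hlaw : ∀ t, P.map (e t) = uniformOn (Set.univ : Set (AgentPair n)))
    (hindep : iIndepFun e P) (hx₀ : Measurable x₀)
    (hx₀indep : IndepFun x₀ (fun ω t => e t ω) P) {g : EuclideanSpace ℝ (Fin n) → ℝ}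
    (hg : Measurable g) {a b : ℝ} (hgab : ∀ x, g x ∈ Set.Icc a b) (t : ℕ) :
    ∫ ω, g (dwState μ r (x₀ ω) (fun s => e s ω) (t + 1)) ∂P =
      ∫ ω, stepMean μ r g (dwState μ r (x₀ ω) (fun s => e s ω) t) ∂P := by
  set X := fun ω => dwState μ r (x₀ ω) (fun s => e s ω) t with hX
  have hXm : Measurable X := measurable_dwState_comp he hx₀ t
  have hgm : ∀ p, Measurable fun ω => g (dwStep μ r (X ω) p) := fun p =>
    hg.comp ((measurable_dwStep μ r p).comp hXm)
  have hgi : ∀ p, Integrable (fun ω => g (dwStep μ r (X ω) p)) P := fun p =>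
    Integrable.of_mem_Icc a b (hgm p).aemeasurable (ae_of_all _ fun ω => hgab _)
  have hind : ∀ p, Measurable fun q : AgentPair n => if q = p then (1 : ℝ) else 0 := fun p =>
    measurable_of_countable _
  have hprob : ∀ p, ∫ ω, (if e t ω = p then (1 : ℝ) else 0) ∂P =
      1 / Fintype.card (AgentPair n) := by
    intro p
    have h₁ : (fun ω => if e t ω = p then (1 : ℝ) else 0) = (e t ⁻¹' {p}).indicator 1 := by
      ext ω
      by_cases h : e t ω = p
      · rw [if_pos h, Set.indicator_of_mem (show ω ∈ e t ⁻¹' {p} from h), Pi.one_apply]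
      · rw [if_neg h, Set.indicator_of_notMem (show ω ∉ e t ⁻¹' {p} from h)]
    rw [h₁, integral_indicator_one (he t (measurableSet_singleton p)), measureReal_def,
      ← Measure.map_apply (he t) (measurableSet_singleton p), hlaw, uniformOn_univ]
    simp
  have hsplit : ∀ ω, g (dwState μ r (x₀ ω) (fun s => e s ω) (t + 1)) =
      ∑ p, (if e t ω = p then (1 : ℝ) else 0) * g (dwStep μ r (X ω) p) := by
    intro ω
    simp only [ite_mul, one_mul, zero_mul, Finset.sum_ite_eq, Finset.mem_univ, if_true]
    rfl
  have hprod : ∀ p, ∫ ω, (if e t ω = p then (1 : ℝ) else 0) * g (dwStep μ r (X ω) p) ∂P =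
      1 / Fintype.card (AgentPair n) * ∫ ω, g (dwStep μ r (X ω) p) ∂P := by
    intro p
    rw [← hprob p]
    have hI := (indepFun_dwState (μ := μ) (r := r) he hindep hx₀ hx₀indep t).symm.comp (hind p)
      (hg.comp (measurable_dwStep μ r p))
    exact hI.integral_fun_mul_eq_mul_integral
      ((hind p).comp (he t)).aestronglyMeasurable (hgm p).aestronglyMeasurable
  have hint : ∀ p, Integrable
      (fun ω => (if e t ω = p then (1 : ℝ) else 0) * g (dwStep μ r (X ω) p)) P := by
    intro p
    refine (hgi p).bdd_mul (c := 1) ((hind p).comp (he t)).aestronglyMeasurable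
      (ae_of_all _ fun ω => ?_)
    by_cases h : e t ω = p <;> simp [h]
  simp only [hsplit, stepMean]
  rw [integral_finsetSum _ fun p _ => hint p, integral_div, integral_finsetSum _ fun p _ => hgi p]
  simp only [hprod, ← Finset.mul_sum]
  ring

end ChainLaw

/-! ### Expected bounds and the limit of the process -/

section RandomProcess

variable {n : ℕ} {μ : ℝ} {r : Fin n → ℝ} {Ω : Type*} [MeasurableSpace Ω] {P : Measure Ω}
  {X : ℕ → Ω → EuclideanSpace ℝ (Fin n)}

/-- `X` is a process in the unit cube updated at each time with a uniformly random pair. -/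
structure IsGossip (μ : ℝ) (r : Fin n → ℝ) (P : Measure Ω)
    (X : ℕ → Ω → EuclideanSpace ℝ (Fin n)) : Prop where
  measurable : ∀ t, Measurable (X t)
  mem_Icc : ∀ t ω i, X t ω i ∈ Set.Icc (0 : ℝ) 1
  step : ∀ t ω, ∃ p, X (t + 1) ω = dwStep μ r (X t ω) p
  integral_succ : ∀ g : EuclideanSpace ℝ (Fin n) → ℝ, Measurable g → ∀ a b : ℝ,
    (∀ x, g x ∈ Set.Icc a b) → ∀ t, ∫ ω, g (X (t + 1) ω) ∂P = ∫ ω, stepMean μ r g (X t ω) ∂P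

namespace IsGossip

theorem settled_of_le (h : IsGossip μ r P X) (hr : ∀ i, 0 < r i) (hμ0 : 0 ≤ μ) (hμ1 : μ ≤ 1)
    {s t : ℕ} (hst : s ≤ t) {ω : Ω} (hs : X s ω ∈ settled r) :
    X t ω ∈ settled r ∧ heardMean r (X t ω) = heardMean r (X s ω) := by
  induction t, hst using Nat.le_induction with
  | base => exact ⟨hs, rfl⟩
  | succ t _ ih =>
    obtain ⟨p, hp⟩ := h.step t ω
    obtain ⟨f, hf⟩ := ih.1.2
    rw [hp, hf.heardMean_dwStep hr hμ0 hμ1]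
    exact ⟨settled_dwStep ih.1 hr hμ0 hμ1 p, ih.2⟩

/-- The excess `n · 1_{unsettled} + dispersion` never increases along the process. -/
theorem antitone_excess (h : IsGossip μ r P X) (hr : ∀ i, 0 < r i) (hμ0 : 0 ≤ μ) (hμ1 : μ ≤ 1)
    (ω : Ω) : Antitone fun t => n * unsettledInd r (X t ω) + settledDispersion r (X t ω) := by
  refine antitone_nat_of_succ_le fun t => ?_
  by_cases hs : X t ω ∈ settled r
  · obtain ⟨p, hp⟩ := h.step t ω
    have hs' := settled_dwStep (μ := μ) hs hr hμ0 hμ1 p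
    rw [hp, unsettledInd_of_mem hs, unsettledInd_of_mem hs', settledDispersion_of_mem hs,
      settledDispersion_of_mem hs', mul_zero, zero_add, zero_add]
    obtain ⟨f, hf⟩ := hs.2
    exact hf.dispersion_dwStep_le hr hμ0 hμ1 p
  -- An unsettled state has excess `n`; settling replaces it by at most `n / 4`.
  · rw [unsettledInd_of_notMem hs, settledDispersion_of_notMem hs]
    have h₁ := settledDispersion_le (r := r) (X (t + 1) ω)
    have h₂ := (unsettledInd_mem_Icc (r := r) (X (t + 1) ω)).2
    have hn : (0 : ℝ) ≤ n := by positivity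
    nlinarith

theorem integrable_comp [IsProbabilityMeasure P] (h : IsGossip μ r P X)
    {g : EuclideanSpace ℝ (Fin n) → ℝ} (hg : Measurable g) {a b : ℝ}
    (hgab : ∀ x, g x ∈ Set.Icc a b) (t : ℕ) : Integrable (fun ω => g (X t ω)) P :=
  Integrable.of_mem_Icc a b (hg.comp (h.measurable t)).aemeasurable (ae_of_all _ fun _ => hgab _)

theorem integrable_unsettledInd [IsProbabilityMeasure P] (h : IsGossip μ r P X) (t : ℕ) :
    Integrable (fun ω => unsettledInd r (X t ω)) P :=
  h.integrable_comp (measurable_unsettledInd r) unsettledInd_mem_Icc t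

theorem integrable_settledDispersion [IsProbabilityMeasure P] (h : IsGossip μ r P X) (t : ℕ) :
    Integrable (fun ω => settledDispersion r (X t ω)) P :=
  h.integrable_comp (measurable_settledDispersion r) settledDispersion_mem_Icc t

theorem integral_add [Nonempty (AgentPair n)] (h : IsGossip μ r P X) (m t : ℕ) :
    ∀ g : EuclideanSpace ℝ (Fin n) → ℝ, Measurable g → ∀ a b : ℝ, (∀ x, g x ∈ Set.Icc a b) →
      ∫ ω, g (X (t + m) ω) ∂P = ∫ ω, (stepMean μ r)^[m] g (X t ω) ∂P := by
  induction m with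
  | zero => intro g _ a b _; rfl
  | succ m ih =>
    intro g hg a b hab
    rw [← add_assoc, h.integral_succ g hg a b hab,
      ih _ (measurable_stepMean hg) a b (stepMean_mem_Icc hab), Function.iterate_succ_apply]

theorem measurable_iterate_stepMean {g : EuclideanSpace ℝ (Fin n) → ℝ} (hg : Measurable g)
    (m : ℕ) : Measurable ((stepMean μ r)^[m] g) := by
  induction m with
  | zero => exact hg
  | succ m ih => rw [Function.iterate_succ_apply']; exact measurable_stepMean ih

theorem integral_unsettledInd_add_le [Nonempty (AgentPair n)] [IsProbabilityMeasure P]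
    (h : IsGossip μ r P X) (hr : ∀ i, 0 < r i) (hμ0 : 0 ≤ μ) (hμ1 : μ ≤ 1) {T : ℕ}
    (hT : ∀ x : EuclideanSpace ℝ (Fin n), (∀ i, x i ∈ Set.Icc (0 : ℝ) 1) →
      ∃ l : List (AgentPair n), l.length ≤ T ∧ l.foldl (dwStep μ r) x ∈ settled r) (t : ℕ) :
    ∫ ω, unsettledInd r (X (t + T) ω) ∂P ≤
      (1 - (1 / Fintype.card (AgentPair n) : ℝ) ^ T) * ∫ ω, unsettledInd r (X t ω) ∂P := by
  rw [h.integral_add T t _ (measurable_unsettledInd r) 0 1 unsettledInd_mem_Icc,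
    ← integral_const_mul]
  refine integral_mono (h.integrable_comp (measurable_iterate_stepMean (measurable_unsettledInd r) T)
    (iterate_stepMean_mem_Icc unsettledInd_mem_Icc T) t)
    ((h.integrable_unsettledInd t).const_mul _) fun ω => ?_
  by_cases hs : X t ω ∈ settled r
  · simp only [iterate_stepMean_of_mem hr hμ0 hμ1 T _ hs, unsettledInd_of_mem hs, mul_zero, le_refl]
  · simp only [unsettledInd_of_notMem hs, mul_one]
    obtain ⟨l, hl, hl'⟩ := hT _ (h.mem_Icc t ω)
    exact iterate_stepMean_le_of_foldl_mem hr hμ0 hμ1 T _ l hl hl'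

theorem antitone_integral_unsettledInd [IsProbabilityMeasure P] (h : IsGossip μ r P X)
    (hr : ∀ i, 0 < r i) (hμ0 : 0 ≤ μ) (hμ1 : μ ≤ 1) :
    Antitone fun t => ∫ ω, unsettledInd r (X t ω) ∂P := by
  refine antitone_nat_of_succ_le fun t =>
    integral_mono (h.integrable_unsettledInd _) (h.integrable_unsettledInd _) fun ω => ?_
  by_cases hs : X t ω ∈ settled r
  · simp only [unsettledInd_of_mem (h.settled_of_le hr hμ0 hμ1 t.le_succ hs).1,
      unsettledInd_of_mem hs, le_refl]
  · simp only [unsettledInd_of_notMem hs]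
    exact (unsettledInd_mem_Icc _).2

theorem integral_unsettledInd_mem_Icc [IsProbabilityMeasure P] (h : IsGossip μ r P X) (t : ℕ) :
    ∫ ω, unsettledInd r (X t ω) ∂P ∈ Set.Icc (0 : ℝ) 1 := by
  refine ⟨integral_nonneg fun ω => (unsettledInd_mem_Icc _).1, ?_⟩
  calc _ ≤ ∫ _ω, (1 : ℝ) ∂P := integral_mono (h.integrable_unsettledInd t) (integrable_const _)
        fun ω => (unsettledInd_mem_Icc _).2
    _ = 1 := by simp

theorem integral_unsettledInd_le [Nonempty (AgentPair n)] [IsProbabilityMeasure P]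
    (h : IsGossip μ r P X) (hr : ∀ i, 0 < r i) (hμ0 : 0 ≤ μ) (hμ1 : μ ≤ 1) {T : ℕ}
    (hT : ∀ x : EuclideanSpace ℝ (Fin n), (∀ i, x i ∈ Set.Icc (0 : ℝ) 1) →
      ∃ l : List (AgentPair n), l.length ≤ T ∧ l.foldl (dwStep μ r) x ∈ settled r)
    {c : ℝ} (hc : c = 1 - (1 / Fintype.card (AgentPair n) : ℝ) ^ T) (hc0 : 0 ≤ c) (t : ℕ) :
    ∫ ω, unsettledInd r (X t ω) ∂P ≤ c ^ (t / (T + 1)) := by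
  have hanti := h.antitone_integral_unsettledInd hr hμ0 hμ1
  have hk : ∀ k : ℕ, ∫ ω, unsettledInd r (X (k * (T + 1)) ω) ∂P ≤ c ^ k := by
    intro k
    induction k with
    | zero => simpa using (h.integral_unsettledInd_mem_Icc 0).2
    | succ k ih =>
      calc _ ≤ ∫ ω, unsettledInd r (X (k * (T + 1) + T) ω) ∂P :=
            -- Blocks have length `T + 1` but only `T` steps are exploited; the last one is
            -- discarded by monotonicity.
            hanti (by rw [add_mul, one_mul]; omega)
        _ ≤ c * ∫ ω, unsettledInd r (X (k * (T + 1)) ω) ∂P := by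
            rw [hc]; exact h.integral_unsettledInd_add_le hr hμ0 hμ1 hT _
        _ ≤ c * c ^ k := mul_le_mul_of_nonneg_left ih hc0
        _ = c ^ (k + 1) := by ring
  exact (hanti (Nat.div_mul_le_self t (T + 1))).trans (hk _)

theorem integral_settledDispersion_add_le [Nonempty (AgentPair n)] [IsProbabilityMeasure P]
    (h : IsGossip μ r P X) (hr : ∀ i, 0 < r i) (hμ0 : 0 ≤ μ) (hμ1 : μ ≤ 1) {lam : ℝ}
    (hlam : lam = 1 - 4 * μ * (1 - μ) / Fintype.card (AgentPair n)) (hlam0 : 0 ≤ lam)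
    (hlam1 : lam ≤ 1) (s m : ℕ) :
    ∫ ω, settledDispersion r (X (s + m) ω) ∂P ≤
      lam ^ m * ∫ ω, settledDispersion r (X s ω) ∂P +
        n / 4 * (∫ ω, unsettledInd r (X s ω) ∂P - ∫ ω, unsettledInd r (X (s + m) ω) ∂P) := by
  have hanti := h.antitone_integral_unsettledInd hr hμ0 hμ1
  have hstep : ∀ t, ∫ ω, settledDispersion r (X (t + 1) ω) ∂P ≤
      lam * ∫ ω, settledDispersion r (X t ω) ∂P +
        n / 4 * (∫ ω, unsettledInd r (X t ω) ∂P - ∫ ω, unsettledInd r (X (t + 1) ω) ∂P) := by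
    intro t
    have hi := h.integrable_comp (measurable_stepMean (μ := μ) (r := r) (measurable_unsettledInd r))
      (stepMean_mem_Icc unsettledInd_mem_Icc) t
    have hd : Integrable (fun ω => unsettledInd r (X t ω) -
        stepMean μ r (unsettledInd r) (X t ω)) P := (h.integrable_unsettledInd t).sub hi
    rw [h.integral_succ _ (measurable_settledDispersion r) _ _ settledDispersion_mem_Icc,
      h.integral_succ _ (measurable_unsettledInd r) _ _ unsettledInd_mem_Icc,
      ← integral_sub (h.integrable_unsettledInd t) hi, ← integral_const_mul, ← integral_const_mul,
      ← MeasureTheory.integral_add ((h.integrable_settledDispersion t).const_mul _)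
        (hd.const_mul _)]
    refine integral_mono (h.integrable_comp (measurable_stepMean (measurable_settledDispersion r))
      (stepMean_mem_Icc settledDispersion_mem_Icc) t)
      (((h.integrable_settledDispersion t).const_mul _).add
        (hd.const_mul _)) fun ω => ?_
    rw [hlam]
    exact stepMean_settledDispersion_le hr hμ0 hμ1 (X t ω)
  induction m with
  | zero => simp
  | succ m ih =>
    have h₁ := hstep (s + m)
    have h₂ := mul_le_mul_of_nonneg_left ih hlam0
    have h₃ : 0 ≤ n / 4 * (∫ ω, unsettledInd r (X s ω) ∂P -
        ∫ ω, unsettledInd r (X (s + m) ω) ∂P) :=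
      mul_nonneg (by positivity) (sub_nonneg.2 (hanti (Nat.le_add_right s m)))
    have h₄ := mul_le_mul_of_nonneg_right hlam1 h₃
    rw [← add_assoc, pow_succ]
    nlinarith

theorem integral_excess_le [Nonempty (AgentPair n)] [IsProbabilityMeasure P]
    (h : IsGossip μ r P X) (hr : ∀ i, 0 < r i) (hμ0 : 0 ≤ μ) (hμ1 : μ ≤ 1) {T : ℕ}
    (hT : ∀ x : EuclideanSpace ℝ (Fin n), (∀ i, x i ∈ Set.Icc (0 : ℝ) 1) →
      ∃ l : List (AgentPair n), l.length ≤ T ∧ l.foldl (dwStep μ r) x ∈ settled r)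
    {c lam : ℝ} (hc : c = 1 - (1 / Fintype.card (AgentPair n) : ℝ) ^ T) (hc0 : 0 ≤ c)
    (hlam : lam = 1 - 4 * μ * (1 - μ) / Fintype.card (AgentPair n)) (hlam0 : 0 ≤ lam)
    (hlam1 : lam ≤ 1) (t : ℕ) :
    ∫ ω, (n * unsettledInd r (X t ω) + settledDispersion r (X t ω)) ∂P ≤
      n * c ^ (t / (2 * (T + 1))) + n / 4 * lam ^ (t / 2) := by
  obtain ⟨m, hm⟩ := Nat.exists_eq_add_of_le (Nat.div_le_self t 2)
  have h₁ := h.integral_settledDispersion_add_le hr hμ0 hμ1 hlam hlam0 hlam1 (t / 2) m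
  rw [← hm] at h₁
  have h₂ := h.integral_unsettledInd_le hr hμ0 hμ1 hT hc hc0 (t / 2)
  rw [Nat.div_div_eq_div_mul] at h₂
  have h₃ : ∫ ω, settledDispersion r (X (t / 2) ω) ∂P ≤ n / 4 := by
    calc _ ≤ ∫ _ω, (n / 4 : ℝ) ∂P := integral_mono (h.integrable_settledDispersion _)
          (integrable_const _) fun ω => (settledDispersion_mem_Icc _).2
      _ = n / 4 := by simp
  have h₄ : lam ^ m ≤ lam ^ (t / 2) := pow_le_pow_of_le_one hlam0 hlam1 (by omega)
  have h₅ : lam ^ m * ∫ ω, settledDispersion r (X (t / 2) ω) ∂P ≤ lam ^ (t / 2) * (n / 4) :=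
    mul_le_mul h₄ h₃ (integral_nonneg fun ω => settledDispersion_nonneg _) (pow_nonneg hlam0 _)
  have h₆ := h.antitone_integral_unsettledInd hr hμ0 hμ1 (Nat.div_le_self t 2)
  simp only at h₆
  have h₇ := (h.integral_unsettledInd_mem_Icc (t / 2)).1
  rw [MeasureTheory.integral_add ((h.integrable_unsettledInd t).const_mul _)
    (h.integrable_settledDispersion t), integral_const_mul]
  have hn : (0 : ℝ) ≤ n := by positivity
  -- With `U` the unsettled probability, `n U(t) + (n/4)(U(t/2) - U(t)) ≤ n U(t/2)` because `U`
  -- decreases.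
  nlinarith [mul_le_mul_of_nonneg_left h₂ hn, mul_le_mul_of_nonneg_left h₆ hn]

theorem exists_limit (h : IsGossip μ r P X) (hr : ∀ i, 0 < r i) (hμ0 : 0 ≤ μ) (hμ1 : μ ≤ 1) :
    ∃ xlim : Ω → EuclideanSpace ℝ (Fin n), Measurable xlim ∧
      (∀ ω i, xlim ω i ∈ Set.Icc (0 : ℝ) 1) ∧
      (∀ ω i j, xlim ω i = xlim ω j ∨ max (r i) (r j) < |xlim ω i - xlim ω j|) ∧
      ∀ ω t, ‖X t ω - xlim ω‖ ^ 2 ≤ n * unsettledInd r (X t ω) + settledDispersion r (X t ω) := by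
  classical
  -- Constant in time once settled. The default `0` on paths that never settle has equal entries, so
  -- the separation property holds for every `ω`.
  let A : ℕ → Ω → EuclideanSpace ℝ (Fin n) := fun t ω =>
    if X t ω ∈ settled r then heardMean r (X t ω) else 0
  have hA : ∀ t, Measurable (A t) := fun t =>
    Measurable.ite (h.measurable t (measurableSet_settled r))
      ((measurable_heardMean r).comp (h.measurable t)) measurable_const
  have hex : ∀ ω, ∃ s, ∀ t, s ≤ t → A t ω = A s ω := by
    intro ω
    by_cases hs : ∃ s, X s ω ∈ settled r
    · obtain ⟨s, hs⟩ := hs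
      refine ⟨s, fun t hst => ?_⟩
      obtain ⟨h₁, h₂⟩ := h.settled_of_le hr hμ0 hμ1 hst hs
      simp only [A, if_pos hs, if_pos h₁, h₂]
    · push Not at hs
      exact ⟨0, fun t _ => by simp only [A, if_neg (hs _)]⟩
  choose s hs using hex
  have hcube : ∀ ω i, A (s ω) ω i ∈ Set.Icc (0 : ℝ) 1 := by
    intro ω i
    simp only [A]
    split_ifs with hset
    · obtain ⟨f, hf⟩ := hset.2
      exact hf.heardMean_mem_Icc fun k _ => hset.1 k
    · simp
  refine ⟨fun ω => A (s ω) ω, ?_, hcube, ?_, ?_⟩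
  -- The settling index `s` is merely chosen; measurability comes from the pointwise limit of `A t`.
  · refine measurable_of_tendsto_metrizable hA (tendsto_pi_nhds.2 fun ω => ?_)
    exact tendsto_atTop_of_eventually_const (i₀ := s ω) (hs ω)
  · intro ω i j
    simp only [A]
    split_ifs with hset
    · obtain ⟨f, hf⟩ := hset.2
      exact hf.heardMean_separated hr i j
    · simp
  · intro ω t
    beta_reduce
    by_cases hset : X t ω ∈ settled r
    · have hlim : A (s ω) ω = heardMean r (X t ω) := by
        rw [← hs ω _ (le_max_left (s ω) t)]
        obtain ⟨h₁, h₂⟩ := h.settled_of_le hr hμ0 hμ1 (le_max_right (s ω) t) hset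
        simp only [A, if_pos h₁, h₂]
      rw [hlim, unsettledInd_of_mem hset, settledDispersion_of_mem hset, mul_zero, zero_add]
      exact le_rfl
    · rw [unsettledInd_of_notMem hset, settledDispersion_of_notMem hset, mul_one, add_zero,
        EuclideanSpace.norm_sq_eq]
      calc _ ≤ ∑ _i : Fin n, (1 : ℝ) := Finset.sum_le_sum fun i _ => by
            have h₁ := h.mem_Icc t ω i
            have h₂ := hcube ω i
            rw [PiLp.sub_apply, Real.norm_eq_abs, sq_abs]
            nlinarith [h₁.1, h₁.2, h₂.1, h₂.2]
        _ = n := by simp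

theorem ae_tendsto_excess [IsProbabilityMeasure P] (h : IsGossip μ r P X) (hr : ∀ i, 0 < r i)
    (hμ0 : 0 ≤ μ) (hμ1 : μ ≤ 1)
    (hlim : Tendsto (fun t => ∫ ω, (n * unsettledInd r (X t ω) + settledDispersion r (X t ω)) ∂P)
      atTop (𝓝 0)) :
    ∀ᵐ ω ∂P, Tendsto (fun t => n * unsettledInd r (X t ω) + settledDispersion r (X t ω))
      atTop (𝓝 0) := by
  refine tendsto_of_integral_tendsto_of_antitone (F := fun _ => 0)
    (fun t => ((h.integrable_unsettledInd t).const_mul _).add (h.integrable_settledDispersion t))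
    (integrable_const _) (by simpa using hlim)
    (ae_of_all _ fun ω => h.antitone_excess hr hμ0 hμ1 ω) (ae_of_all _ fun ω t => ?_)
  exact add_nonneg (mul_nonneg (by positivity) (unsettledInd_mem_Icc _).1)
    (settledDispersion_nonneg _)

end IsGossip

/-- Within `dwT` steps every state of the unit cube can be brought to a settled one. -/
theorem exists_foldl_mem_settled {n : ℕ} {μ : ℝ} (hμ : 1 / 2 ≤ μ) (hμ1 : μ < 1) {r : Fin n → ℝ}
    {rmax rmin : ℝ} (hmin0 : 0 < rmin) (hmin : ∀ i, rmin ≤ r i) (hmax0 : 0 < rmax)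
    (hmax : ∀ i, r i ≤ rmax) (x : EuclideanSpace ℝ (Fin n)) (hx : ∀ i, x i ∈ Set.Icc (0 : ℝ) 1) :
    ∃ l : List (AgentPair n), l.length ≤ dwT n μ rmax rmin ∧
      l.foldl (dwStep μ r) x ∈ settled r := by
  have hν : 0 < 1 - μ := by linarith
  have hL : ∀ i, r i * (1 - μ) ^ ⌈Real.logb (1 - μ) (rmin / rmax)⌉₊ ≤ rmin := by
    intro i
    have h₁ : (1 - μ) ^ ⌈Real.logb (1 - μ) (rmin / rmax)⌉₊ ≤ rmin / rmax := by
      rw [← Real.rpow_natCast]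
      calc _ ≤ (1 - μ) ^ Real.logb (1 - μ) (rmin / rmax) :=
            Real.rpow_le_rpow_of_exponent_ge hν (by linarith) (Nat.le_ceil _)
        _ = rmin / rmax := Real.rpow_logb hν (by linarith) (div_pos hmin0 hmax0)
    calc _ ≤ rmax * (rmin / rmax) := mul_le_mul (hmax i) h₁ (by positivity) hmax0.le
      _ = rmin := by field_simp
  -- The unit interval has length at most `rmin + K (1 - μ)² rmin`, the initial allowance of
  -- `reachIn_clustered`.
  have hK : 1 - rmin ≤ ⌈(1 - rmin) / ((1 - μ) ^ 2 * rmin)⌉₊ * ((1 - μ) ^ 2 * rmin) := by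
    rw [← div_le_iff₀ (by positivity)]
    exact Nat.le_ceil _
  obtain ⟨l, h₁, -, ⟨f, -, hf⟩, hcube⟩ := (reachIn_clustered hμ hμ1 hmin0 hmin hL
    ⌈(1 - rmin) / ((1 - μ) ^ 2 * rmin)⌉₊ Finset.univ x fun i _ j _ => by
      linarith [(hx i).2, (hx j).1]).and_mem_Icc (by linarith) hμ1.le fun i _ => hx i
  refine ⟨l, h₁.trans_eq ?_, fun i => hcube i (Finset.mem_univ i), f, hf⟩
  rw [dwT]
  ring

end RandomProcess

/-! ### The main theorem -/

theorem theorem1 (n : ℕ) (hn : 3 ≤ n) (μ : ℝ) (hμ : 1 / 2 ≤ μ) (hμ1 : μ < 1)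
    (r : Fin n → ℝ) (hr : Antitone r) (hrpos : ∀ i, 0 < r i)
    {Ω : Type*} [MeasurableSpace Ω] (P : Measure Ω) [IsProbabilityMeasure P]
    -- the pairs selected at times 0, 1, 2, ... are independent and uniform
    (e : ℕ → Ω → AgentPair n) (he : ∀ t, Measurable (e t))
    (hlaw : ∀ t, P.map (e t) = uniformOn (Set.univ : Set (AgentPair n)))
    (hindep : iIndepFun e P)
    -- the initial state: deterministic, or random and independent of the selected pairs
    (x₀ : Ω → EuclideanSpace ℝ (Fin n)) (hx₀ : Measurable x₀)
    (hx₀mem : ∀ ω i, x₀ ω i ∈ Set.Icc (0 : ℝ) 1)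
    (hx₀indep : IndepFun x₀ (fun ω t => e t ω) P) :
    ∃ xlim : Ω → EuclideanSpace ℝ (Fin n), Measurable xlim ∧
      (∀ ω i, xlim ω i ∈ Set.Icc (0 : ℝ) 1) ∧
      (∀ ω i j, i ≠ j → xlim ω i = xlim ω j ∨ max (r i) (r j) < |xlim ω i - xlim ω j|) ∧
      (∀ᵐ ω ∂P, Tendsto (fun t => dwState μ r (x₀ ω) (fun s => e s ω) t) atTop (𝓝 (xlim ω))) ∧
      (∀ t : ℕ,
        Integrable (fun ω => ‖dwState μ r (x₀ ω) (fun s => e s ω) t - xlim ω‖ ^ 2) P ∧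
        ∫ ω, ‖dwState μ r (x₀ ω) (fun s => e s ω) t - xlim ω‖ ^ 2 ∂P ≤
          n * dwC n (dwT n μ (r ⟨0, by omega⟩) (r ⟨n - 1, by omega⟩)) ^
                (t / (2 * (dwT n μ (r ⟨0, by omega⟩) (r ⟨n - 1, by omega⟩) + 1))) +
            n / 4 * (1 - 8 * μ * (1 - μ) / (n * (n - 1))) ^ (t / 2)) := by
  have hμ0 : 0 ≤ μ := by linarith
  have hn3 : (3 : ℝ) ≤ n := by exact_mod_cast hn
  have hpair : Nonempty (AgentPair n) :=
    ⟨⟨(⟨0, by omega⟩, ⟨1, by omega⟩), Fin.mk_lt_mk.2 Nat.zero_lt_one⟩⟩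
  set X : ℕ → Ω → EuclideanSpace ℝ (Fin n) := fun t ω => dwState μ r (x₀ ω) (fun s => e s ω) t
  have hX : IsGossip μ r P X :=
    { measurable := measurable_dwState_comp he hx₀
      mem_Icc := fun t ω => by
        induction t with
        | zero => exact hx₀mem ω
        | succ t ih =>
          exact fun i => dwStep_mem_Icc hμ0 hμ1.le (S := Finset.univ) (fun i _ => ih i)
            (Finset.mem_univ _) (Finset.mem_univ _) i (Finset.mem_univ i)
      step := fun t ω => ⟨e t ω, rfl⟩
      integral_succ := fun g hg a b hab t =>
        integral_comp_dwState_succ he hlaw hindep hx₀ hx₀indep hg hab t }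
  set T := dwT n μ (r ⟨0, by omega⟩) (r ⟨n - 1, by omega⟩)
  have hT : ∀ x : EuclideanSpace ℝ (Fin n), (∀ i, x i ∈ Set.Icc (0 : ℝ) 1) →
      ∃ l : List (AgentPair n), l.length ≤ T ∧ l.foldl (dwStep μ r) x ∈ settled r :=
    exists_foldl_mem_settled hμ hμ1 (hrpos _)
      (fun i => hr (Fin.mk_le_mk.2 (by have := i.2; omega))) (hrpos _)
      (fun i => hr (Fin.mk_le_mk.2 (Nat.zero_le _)))
  have hN := card_agentPair n
  have hN1 : (1 : ℝ) ≤ Fintype.card (AgentPair n) := by exact_mod_cast Fintype.card_pos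
  have hN0 : (0 : ℝ) < Fintype.card (AgentPair n) := by linarith
  have hc : dwC n T = 1 - (1 / Fintype.card (AgentPair n) : ℝ) ^ T := by
    rw [dwC, ← mul_pow, ← hN, ← div_pow]
    congr 2
    field_simp
  have hc0 : 0 ≤ dwC n T := by
    rw [hc, sub_nonneg]
    exact pow_le_one₀ (by positivity) (by rw [div_le_one hN0]; exact hN1)
  have hc1 : dwC n T < 1 := by
    rw [hc]
    linarith [pow_pos (one_div_pos.2 hN0) T]
  have hlam : 1 - 8 * μ * (1 - μ) / (n * (n - 1)) =
      1 - 4 * μ * (1 - μ) / Fintype.card (AgentPair n) := by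
    rw [← hN]
    field_simp
    ring
  have hμ4 : 0 < 4 * μ * (1 - μ) := by nlinarith
  have hlam0 : 0 ≤ 1 - 8 * μ * (1 - μ) / (n * (n - 1)) := by
    rw [hlam, sub_nonneg, div_le_one hN0]
    -- Here `4μ(1 - μ) ≤ 1 ≤ N`.
    nlinarith [sq_nonneg (2 * μ - 1)]
  have hlam1 : 1 - 8 * μ * (1 - μ) / (n * (n - 1)) < 1 := by
    rw [hlam, sub_lt_self_iff]
    positivity
  have hbound := hX.integral_excess_le hrpos hμ0 hμ1.le hT hc hc0 hlam hlam0 hlam1.le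
  have htend : Tendsto (fun t : ℕ => n * dwC n T ^ (t / (2 * (T + 1))) +
      n / 4 * (1 - 8 * μ * (1 - μ) / (n * (n - 1))) ^ (t / 2)) atTop (𝓝 0) := by
    have h₁ := ((tendsto_pow_atTop_nhds_zero_of_lt_one hc0 hc1).comp
      (Nat.tendsto_div_const_atTop (show 2 * (T + 1) ≠ 0 by omega))).const_mul (n : ℝ)
    have h₂ := ((tendsto_pow_atTop_nhds_zero_of_lt_one hlam0 hlam1).comp
      (Nat.tendsto_div_const_atTop two_ne_zero)).const_mul (n / 4 : ℝ)
    simpa using h₁.add h₂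
  have hexc0 : ∀ ω t, 0 ≤ n * unsettledInd r (X t ω) + settledDispersion r (X t ω) := fun ω t =>
    add_nonneg (mul_nonneg (by positivity) (unsettledInd_mem_Icc _).1) (settledDispersion_nonneg _)
  obtain ⟨xlim, hmeas, hcube, hsep, hdist⟩ := hX.exists_limit hrpos hμ0 hμ1.le
  refine ⟨xlim, hmeas, hcube, fun ω i j _ => hsep ω i j, ?_, fun t => ?_⟩
  · have hae := hX.ae_tendsto_excess hrpos hμ0 hμ1.le
      (squeeze_zero (fun t => integral_nonneg fun ω => hexc0 ω t) hbound htend)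
    filter_upwards [hae] with ω hω
    rw [tendsto_iff_norm_sub_tendsto_zero]
    have h₁ := (squeeze_zero (fun t => sq_nonneg _) (hdist ω) hω).sqrt
    simpa [Real.sqrt_sq] using h₁
  · have hint := ((hX.integrable_unsettledInd t).const_mul (n : ℝ)).add
      (hX.integrable_settledDispersion t)
    have hmeas' : Measurable fun ω => ‖X t ω - xlim ω‖ ^ 2 :=
      (((hX.measurable t).sub hmeas).norm).pow_const 2
    have hint' : Integrable (fun ω => ‖X t ω - xlim ω‖ ^ 2) P := by
      refine hint.mono' hmeas'.aestronglyMeasurable (ae_of_all _ fun ω => ?_)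
      rw [Real.norm_of_nonneg (sq_nonneg _)]
      exact hdist ω t
    exact ⟨hint', (integral_mono hint' hint fun ω => hdist ω t).trans (hbound t)⟩
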